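/- **Model.** Let $\Phi,\phi$ be the standard normal distribution function and density. Fix real sequences $(a_j),(b_j),(\omega_j),(\varphi_j)$, a sequence $\lambda_j>0$ ($j\in\mathbb N$) and a real $\rho$. For $\xi=(\theta,\tau)\in\mathbb R^2$ let $P_\xi$ be the law of a sequence $(R_j,T_j)_{j\in\mathbb N}$ of independent pairs with $R_j$ and $T_j$ independent, $R_j\sim\mathrm{Bernoulli}(\Phi(a_j\theta+b_j))$ and $\log T_j\sim N(\omega_j-\varphi_j\tau,\lambda_j)$. Put $\Sigma=\begin{pmatrix}1&\rho\\ \rho&1\end{pmatrix}$, let $l^{(J)}(\xi)$ be the log likelihood of the first $J$ pairs, and let $$\tilde l^{(J)}(\xi)=l^{(J)}(\xi)-\tfrac12\xi^\top\Sigma^{-1}\xi,\qquad \tilde{\mathcal I}_J(\xi)=-E_\xi\big[\nabla^2_\xi\tilde l^{(J)}(\xi)\big].$$ Let $\tilde\xi_J$ be the maximizer of $\tilde l^{(J)}$ on $\mathbb R^2$ (the posterior mode), $\tilde{\mathcal I}_J^{1/2}$ the positive semidefinite square root, and let $P(\xi\in\cdot\mid R^{(J)},T^{(J)})$ be the posterior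 of $\xi$ given the first $J$ pairs under the prior $N(0,\Sigma)$, given by Bayes' formula. **Assumptions.** (A1) For every compact $K\subset\mathbb R$, $|a_j\phi(a_j\theta+b_j)|$, $|a_j^2\phi'(a_j\theta+b_j)|$ and $|a_j^3\phi''(a_j\theta+b_j)|$ are bounded uniformly in $j\in\mathbb N$, $\theta\in K$, and there are $0<d_0<d_1<1$ with $d_0\le\Phi(a_j\theta+b_j)\le d_1$ for all $j$ and all $\theta\in K$. Moreover $\sup_j\varphi_j^2/\lambda_j<\infty$. (A2) at $\xi_0=(\theta_0,\tau_0)$: there are functions $c_1,c_2:\mathbb R\to\mathbb R$ such that for all $\theta\ne\theta_0$ and all $\tau\neq\tau_0$ one has $c_1(\theta)<0$, $c_2(\tau)<0$ and $$\limsup_{J\to\infty}\frac1J\sum_{j=1}^J\Big[\Phi(a_j\theta_0+b_j)\log\frac{\Phi(a_j\theta+b_j)}{\Phi(a_j\theta_0+b_j)}+\Phi(-a_j\theta_0-b_j)\log\frac{\Phi(-a_j\theta-b_j)}{\Phi(-a_j\theta_0-b_j)}\Big]\le c_1(\theta),$$ $$\limsup_{J\to\infty}-\frac1J\sum_{j=1}^J\frac1{2\lambda_j}\Big[2\varphi_j(\tau-\tau_0)(\omega_j-\varphi_j\tau_0)+\varphi_j^2(\tau^2-\tau_0^2)-2\varphi_j\omega_j(\tau-\tau_0)\Big]\le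 c_2(\tau),$$ and for every $\delta>0$, $\sup_{|\theta-\theta_0|\ge\delta}c_1(\theta)<0$ and $\sup_{|\tau-\tau_0|\ge\delta}c_2(\tau)<0$. (A3) at $\xi_0$: $\sum_j\varphi_j^2/\lambda_j>0$, $\sum_j\frac{a_j^2\phi(a_j\theta_0+b_j)^2}{\Phi(a_j\theta_0+b_j)[1-\Phi(a_j\theta_0+b_j)]}>0$ (the sums lie in $[0,\infty]$), and $|\rho|<1$. **Theorem.** (i) If $|\rho|<1$, then for every $J$ and all data with $T_j>0$ the maximizer $\tilde\xi_J$ exists and is unique, and for all $J$ and $\xi=(\theta,\tau)$ the $(\theta,\theta)$ entry of the posterior information is $$\big(\tilde{\mathcal I}_J(\xi)\big)_{11}=\frac1{1-\rho^2}+\sum_{j=1}^J\frac{a_j^2\phi(a_j\theta+b_j)^2}{\Phi(a_j\theta+b_j)[1-\Phi(a_j\theta+b_j)]}.$$ (ii) Assume (A1). For every fixed $\xi_0\in\mathbb R^2$ at which (A2) and (A3) hold, and every Borel set $B\subseteq\mathbb R^2$, $$P\big(\tilde{\mathcal I}_J(\tilde\xi_J)^{1/2}(\xi-\tilde\xi_J)\in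 B\,\big|\,R^{(J)},T^{(J)}\big)\longrightarrow P(z\in B),\quad z\sim N(0,I_2),\qquad J\to\infty,$$ in $P_{\xi_0}$-probability, the data being drawn from $P_{\xi_0}$. (iii) Assume (A1). Let $\mathcal G$ be a probability measure on $\mathbb R^2$ that is absolutely continuous with respect to Lebesgue measure, such that (A2) and (A3) hold at $\mathcal G$-almost every $\xi_0$. If $\xi_0\sim\mathcal G$ and, given $\xi_0$, the data are drawn from $P_{\xi_0}$, then for every Borel set $B\subseteq\mathbb R^2$ the convergence in (ii) holds in probability under the joint law of $\xi_0$ and the data. -/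

import Mathlib

open MeasureTheory ProbabilityTheory Filter Topology
open scoped NNReal ENNReal

noncomputable section

namespace LaRT

/-- Standard normal cumulative distribution function `Φ`. -/
def Phi (x : ℝ) : ℝ := cdf (gaussianReal 0 1) x

/-- Standard normal density `φ`. -/
def phi (x : ℝ) : ℝ := gaussianPDFReal 0 1 x

/-- Population parameters of the model with an infinite sequence of items: accuracy discriminations
`a j` and intercepts `b j`, CoT intensities `ω j`, CoT discriminations `φ j` (here `vphi`),
residual variances `λ j > 0` (here `lam`), and the correlation `ρ` of the latent traits. -/
structure Params where
  a : ℕ → ℝ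
  b : ℕ → ℝ
  omega : ℕ → ℝ
  vphi : ℕ → ℝ
  lam : ℕ → ℝ≥0
  rho : ℝ
  lam_pos : ∀ j, 0 < lam j

/-- Latent traits `ξ = (θ, τ)`: the ability is `ξ 0`, the speed is `ξ 1`. -/
abbrev Trait := Fin 2 → ℝ

/-- The data `(R_j, T_j)`, `j ∈ ℕ`, of one subject: `(x j).1 = R_j` (`true` means a correct answer)
and `(x j).2 = T_j`. -/
abbrev Data := ℕ → Bool × ℝ

namespace Params

variable (m : Params)

/-- Law of the accuracy `R_j ∼ Bernoulli(Φ(a_j θ + b_j))`. -/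
def accLaw (j : ℕ) (θ : ℝ) : Measure Bool :=
  ENNReal.ofReal (Phi (m.a j * θ + m.b j)) • Measure.dirac true
    + ENNReal.ofReal (1 - Phi (m.a j * θ + m.b j)) • Measure.dirac false

/-- Law of the CoT length `T_j`, where `log T_j ∼ N(ω_j - φ_j τ, λ_j)`. -/
def cotLaw (j : ℕ) (τ : ℝ) : Measure ℝ :=
  (gaussianReal (m.omega j - m.vphi j * τ) (m.lam j)).map Real.exp

instance (j : ℕ) (θ : ℝ) : IsProbabilityMeasure (m.accLaw j θ) := by
  constructor
  have h0 : 0 ≤ Phi (m.a j * θ + m.b j) := cdf_nonneg _ _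
  have h1 : Phi (m.a j * θ + m.b j) ≤ 1 := cdf_le_one _ _
  simp only [accLaw, Measure.coe_add, Measure.coe_smul, Pi.add_apply, Pi.smul_apply, smul_eq_mul,
    measure_univ, mul_one]
  rw [← ENNReal.ofReal_add h0 (by linarith)]
  simp

instance (j : ℕ) (τ : ℝ) : IsProbabilityMeasure (m.cotLaw j τ) :=
  Measure.isProbabilityMeasure_map Real.measurable_exp.aemeasurable

/-- The law `P_ξ` of the whole data sequence given the traits `ξ`: given `ξ`, all the `R_j` and
`T_j` are independent. -/
def dataLaw (ξ : Trait) : Measure Data :=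
  Measure.infinitePi fun j => (m.accLaw j (ξ 0)).prod (m.cotLaw j (ξ 1))

instance (ξ : Trait) : IsProbabilityMeasure (m.dataLaw ξ) := by
  unfold dataLaw; infer_instance

theorem measurable_Phi : Measurable Phi := (monotone_cdf (gaussianReal 0 1)).measurable

theorem measurable_accLaw (j : ℕ) : Measurable (m.accLaw j) := by
  refine Measure.measurable_of_measurable_coe _ fun s _ => ?_
  have h : Measurable fun θ : ℝ => Phi (m.a j * θ + m.b j) := measurable_Phi.comp (by fun_prop)
  simp only [accLaw, Measure.coe_add, Measure.coe_smul, Pi.add_apply, Pi.smul_apply, smul_eq_mul]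
  exact (h.ennreal_ofReal.mul_const _).add ((h.const_sub 1).ennreal_ofReal.mul_const _)

theorem measurable_cotLaw (j : ℕ) : Measurable (m.cotLaw j) := by
  refine (Measure.measurable_map _ Real.measurable_exp).comp ?_
  exact measurable_gaussianReal.comp
    (f := fun τ : ℝ => (m.omega j - m.vphi j * τ, m.lam j)) (by fun_prop)

theorem measurable_dataLaw : Measurable m.dataLaw := by
  have key : ∀ j, Measurable fun ξ : Trait => (m.accLaw j (ξ 0)).prod (m.cotLaw j (ξ 1)) := by
    intro j
    let κ : Kernel Trait Bool := ⟨fun ξ => m.accLaw j (ξ 0),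
      (m.measurable_accLaw j).comp (measurable_pi_apply 0)⟩
    let η : Kernel Trait ℝ := ⟨fun ξ => m.cotLaw j (ξ 1),
      (m.measurable_cotLaw j).comp (measurable_pi_apply 1)⟩
    have : IsMarkovKernel κ := ⟨fun ξ => by change IsProbabilityMeasure (m.accLaw j _); infer_instance⟩
    have : IsMarkovKernel η := ⟨fun ξ => by change IsProbabilityMeasure (m.cotLaw j _); infer_instance⟩
    have h := (κ ×ₖ η).measurable
    have e : ⇑(κ ×ₖ η) = fun ξ : Trait => (m.accLaw j (ξ 0)).prod (m.cotLaw j (ξ 1)) := by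
      funext ξ
      rw [Kernel.prod_apply]
      rfl
    rwa [e] at h
  refine Measurable.measure_of_isPiSystem_of_isProbabilityMeasure
    generateFrom_squareCylinders.symm
    (isPiSystem_squareCylinders (fun _ => MeasurableSpace.isPiSystem_measurableSet) (by simp)) ?_
  rintro _ ⟨s, t, ht, rfl⟩
  simp only [dataLaw]
  have ht' : ∀ i, MeasurableSet (t i) := fun i => ht i (Set.mem_univ i)
  simp_rw [Measure.infinitePi_pi _ (fun i _ => ht' i)]
  exact Finset.measurable_prod _ fun i _ => (Measure.measurable_coe (ht' i)).comp (key i)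

/-- The model `ξ ↦ P_ξ` as a Markov kernel. -/
def dataKernel : Kernel Trait Data := ⟨m.dataLaw, m.measurable_dataLaw⟩

instance : IsMarkovKernel m.dataKernel :=
  ⟨fun ξ => by change IsProbabilityMeasure (m.dataLaw ξ); infer_instance⟩

/-- The likelihood contribution `P(R_j ∣ θ)` of an accuracy. -/
def accLik (j : ℕ) (r : Bool) (θ : ℝ) : ℝ :=
  if r then Phi (m.a j * θ + m.b j) else 1 - Phi (m.a j * θ + m.b j)

/-- The likelihood contribution `P(T_j ∣ τ)` of a CoT length: the log-normal density at `t > 0`. -/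
def cotLik (j : ℕ) (t τ : ℝ) : ℝ :=
  gaussianPDFReal (m.omega j - m.vphi j * τ) (m.lam j) (Real.log t) / t

/-- The likelihood of the first `J` items. -/
def lik (J : ℕ) (x : Data) (ξ : Trait) : ℝ :=
  ∏ j ∈ Finset.range J, m.accLik j (x j).1 (ξ 0) * m.cotLik j (x j).2 (ξ 1)

/-- The log likelihood `l^{(J)}` of the first `J` items. -/
def logLik (J : ℕ) (x : Data) (ξ : Trait) : ℝ :=
  ∑ j ∈ Finset.range J,
    (Real.log (m.accLik j (x j).1 (ξ 0)) + Real.log (m.cotLik j (x j).2 (ξ 1)))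

/-- The correlation matrix `Σ` of the latent traits. -/
def Sigma : Matrix (Fin 2) (Fin 2) ℝ := !![1, m.rho; m.rho, 1]

/-- The quadratic form `ξᵀ Σ⁻¹ ξ`. -/
def quad (ξ : Trait) : ℝ := dotProduct ξ (m.Sigma⁻¹.mulVec ξ)

/-- The prior density, that of `N(0, Σ)`. -/
def prior (ξ : Trait) : ℝ :=
  (2 * Real.pi * Real.sqrt m.Sigma.det)⁻¹ * Real.exp (-(1 / 2) * m.quad ξ)

/-- The log posterior `l̃^{(J)}`, up to an additive constant. -/
def logPost (J : ℕ) (x : Data) (ξ : Trait) : ℝ := m.logLik J x ξ - 1 / 2 * m.quad ξ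

/-- The posterior mode `ξ̃_J` (the maximum a posteriori estimate). -/
def mode (J : ℕ) (x : Data) : Trait :=
  Classical.epsilon fun ξ => ∀ η, m.logPost J x η ≤ m.logPost J x ξ

/-- Prior density times likelihood, as an unnormalized measure on the traits. -/
def jointMeasure (J : ℕ) (x : Data) : Measure Trait :=
  volume.withDensity fun ξ => ENNReal.ofReal (m.prior ξ * m.lik J x ξ)

/-- The posterior distribution of `ξ` given the data of the first `J` items (Bayes' formula). -/
def posterior (J : ℕ) (x : Data) : Measure Trait :=
  (m.jointMeasure J x Set.univ)⁻¹ • m.jointMeasure J x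

/-- The Hessian matrix of second partial derivatives of `f` at `ξ`. -/
def hessian (f : Trait → ℝ) (ξ : Trait) : Matrix (Fin 2) (Fin 2) ℝ :=
  Matrix.of fun i k =>
    lineDeriv ℝ (fun η => lineDeriv ℝ f η (Pi.single k 1)) ξ (Pi.single i 1)

/-- The posterior information `Ĩ_J(ξ) = -E_ξ[∇² l̃^{(J)}(ξ)]`; the expectation is entrywise. -/
def postInfo (J : ℕ) (ξ : Trait) : Matrix (Fin 2) (Fin 2) ℝ :=
  Matrix.of fun i k => -∫ x, hessian (m.logPost J x) ξ i k ∂(m.dataLaw ξ)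

open scoped MatrixOrder in
/-- The positive semidefinite square root `Ĩ_J(ξ)^{1/2}`. -/
def sqrtPostInfo (J : ℕ) (ξ : Trait) : Matrix (Fin 2) (Fin 2) ℝ := CFC.sqrt (m.postInfo J ξ)

/-- The posterior probability `P(Ĩ_J(ξ̃_J)^{1/2} (ξ - ξ̃_J) ∈ B ∣ R^{(J)}, T^{(J)})`. -/
def postProb (B : Set Trait) (J : ℕ) (x : Data) : ℝ :=
  (m.posterior J x).real {ξ | (m.sqrtPostInfo J (m.mode J x)).mulVec (ξ - m.mode J x) ∈ B}

/-- Boundedness of the item functions: on every compact set of abilities the item functions are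
bounded uniformly in the item and the success probabilities stay away from `0` and `1`, and
`φ_j² / λ_j` is bounded. -/
def BoundedItems : Prop :=
  (∀ K : Set ℝ, IsCompact K →
    (∃ M : ℝ, ∀ j, ∀ θ ∈ K,
      |m.a j * phi (m.a j * θ + m.b j)| ≤ M ∧
      |m.a j ^ 2 * deriv phi (m.a j * θ + m.b j)| ≤ M ∧
      |m.a j ^ 3 * deriv (deriv phi) (m.a j * θ + m.b j)| ≤ M) ∧
    ∃ d₀ d₁ : ℝ, 0 < d₀ ∧ d₀ < d₁ ∧ d₁ < 1 ∧ ∀ j, ∀ θ ∈ K,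
      d₀ ≤ Phi (m.a j * θ + m.b j) ∧ Phi (m.a j * θ + m.b j) ≤ d₁) ∧
  ∃ C : ℝ, ∀ j, m.vphi j ^ 2 / (m.lam j : ℝ) ≤ C

/-- Expected log likelihood ratio of `θ` against the truth `θ₀` for the accuracy of item `j`. -/
def accGap (j : ℕ) (θ₀ θ : ℝ) : ℝ :=
  Phi (m.a j * θ₀ + m.b j) *
      Real.log (Phi (m.a j * θ + m.b j) / Phi (m.a j * θ₀ + m.b j))
    + Phi (-m.a j * θ₀ - m.b j) *
      Real.log (Phi (-m.a j * θ - m.b j) / Phi (-m.a j * θ₀ - m.b j))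

/-- Expected log likelihood ratio of `τ` against the truth `τ₀` for the CoT length of item `j`. -/
def cotGap (j : ℕ) (τ₀ τ : ℝ) : ℝ :=
  -(1 / (2 * (m.lam j : ℝ)) *
    (2 * m.vphi j * (τ - τ₀) * (m.omega j - m.vphi j * τ₀) + m.vphi j ^ 2 * (τ ^ 2 - τ₀ ^ 2)
      - 2 * m.vphi j * m.omega j * (τ - τ₀)))

/-- `limsup_J J⁻¹ ∑_{j < J} u_j`, as an extended real number. -/
def limsupAvg (u : ℕ → ℝ) : EReal :=
  limsup (fun J : ℕ => (((1 / (J : ℝ)) * ∑ j ∈ Finset.range J, u j : ℝ) : EReal)) atTop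

/-- Identifiability of the latent traits at `ξ₀`, coordinate by coordinate. -/
def Identifiable (ξ₀ : Trait) : Prop :=
  ∃ c₁ c₂ : ℝ → ℝ,
    (∀ θ, θ ≠ ξ₀ 0 → c₁ θ < 0 ∧ limsupAvg (fun j => m.accGap j (ξ₀ 0) θ) ≤ (c₁ θ : EReal)) ∧
    (∀ τ, τ ≠ ξ₀ 1 → c₂ τ < 0 ∧ limsupAvg (fun j => m.cotGap j (ξ₀ 1) τ) ≤ (c₂ τ : EReal)) ∧
    ∀ δ : ℝ, 0 < δ → ∃ k : ℝ, k < 0 ∧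
      (∀ θ, δ ≤ |θ - ξ₀ 0| → c₁ θ ≤ k) ∧ (∀ τ, δ ≤ |τ - ξ₀ 1| → c₂ τ ≤ k)

/-- Fisher information about `θ` in the accuracy of item `j`. -/
def accInfo (j : ℕ) (θ : ℝ) : ℝ :=
  m.a j ^ 2 * phi (m.a j * θ + m.b j) ^ 2 /
    (Phi (m.a j * θ + m.b j) * (1 - Phi (m.a j * θ + m.b j)))

/-- Non-degenerate information at `ξ₀`; the sums over all items may be infinite. -/
def NonDegenerate (ξ₀ : Trait) : Prop :=
  0 < ∑' j, ENNReal.ofReal (m.vphi j ^ 2 / (m.lam j : ℝ)) ∧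
  0 < ∑' j, ENNReal.ofReal (m.accInfo j (ξ₀ 0)) ∧
  |m.rho| < 1

end Params

/-- The standard bivariate normal distribution `N(0, I₂)`. -/
def stdNormal₂ : Measure Trait := Measure.pi fun _ => gaussianReal 0 1

end LaRT

end

noncomputable section

namespace LaRT

/-! ### Calculus of the normal distribution function -/

theorem phi_eq (z : ℝ) : phi z = (Real.sqrt (2 * Real.pi))⁻¹ * Real.exp (-(z ^ 2) / 2) := by
  simp [phi, gaussianPDFReal]

theorem phi_pos (z : ℝ) : 0 < phi z := gaussianPDFReal_pos _ _ _ one_ne_zero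

theorem phi_neg (z : ℝ) : phi (-z) = phi z := by simp [phi_eq]

theorem hasDerivAt_phi (z : ℝ) : HasDerivAt phi (-(z * phi z)) z := by
  have h : HasDerivAt (fun z : ℝ => (Real.sqrt (2 * Real.pi))⁻¹ * Real.exp (-(z ^ 2) / 2))
      ((Real.sqrt (2 * Real.pi))⁻¹ * (Real.exp (-(z ^ 2) / 2) * (-(2 * z) / 2))) z := by
    have h1 : HasDerivAt (fun z : ℝ => -(z ^ 2) / 2) (-(2 * z) / 2) z := by
      simpa using ((hasDerivAt_pow 2 z).neg.div_const 2)
    exact (h1.exp).const_mul _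
  have e : phi = fun z : ℝ => (Real.sqrt (2 * Real.pi))⁻¹ * Real.exp (-(z ^ 2) / 2) :=
    funext phi_eq
  rw [e]
  convert h using 1
  ring

theorem continuous_phi : Continuous phi :=
  continuous_iff_continuousAt.2 fun z => (hasDerivAt_phi z).continuousAt

theorem integrable_phi : Integrable phi := integrable_gaussianPDFReal 0 1

theorem Phi_eq_integral (z : ℝ) : Phi z = ∫ t in Set.Iic z, phi t := by
  rw [Phi, cdf_eq_real, Measure.real, gaussianReal_apply_eq_integral _ one_ne_zero]
  exact ENNReal.toReal_ofReal (setIntegral_nonneg measurableSet_Iic fun t _ => (phi_pos t).le)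

theorem hasDerivAt_Phi (z : ℝ) : HasDerivAt Phi (phi z) z := by
  have e : Phi = fun z => (∫ t in (0 : ℝ)..z, phi t) + Phi 0 := by
    funext z
    rw [Phi_eq_integral, Phi_eq_integral, ← intervalIntegral.integral_Iic_sub_Iic
      integrable_phi.integrableOn integrable_phi.integrableOn]
    ring
  rw [e]
  exact (intervalIntegral.integral_hasDerivAt_right integrable_phi.intervalIntegrable
    (continuous_phi.stronglyMeasurableAtFilter _ _) continuous_phi.continuousAt).add_const _

theorem strictMono_Phi : StrictMono Phi :=
  strictMono_of_deriv_pos fun z => by rw [(hasDerivAt_Phi z).deriv]; exact phi_pos z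

theorem Phi_pos (z : ℝ) : 0 < Phi z :=
  (cdf_nonneg _ (z - 1)).trans_lt (strictMono_Phi (by linarith : z - 1 < z))

theorem Phi_lt_one (z : ℝ) : Phi z < 1 :=
  (strictMono_Phi (by linarith : z < z + 1)).trans_le (cdf_le_one _ _)

theorem Phi_neg (z : ℝ) : Phi (-z) = 1 - Phi z := by
  have hd : ∀ z, HasDerivAt (fun z => Phi z + Phi (-z)) 0 z := fun z => by
    have := (hasDerivAt_Phi z).fun_add ((hasDerivAt_Phi (-z)).comp z (hasDerivAt_neg z))
    simpa [phi_neg, Function.comp_def] using this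
  have hc : ∀ x y, Phi x + Phi (-x) = Phi y + Phi (-y) :=
    is_const_of_deriv_eq_zero (fun z => (hd z).differentiableAt) fun z => (hd z).deriv
  have hl : Tendsto (fun z => Phi z + Phi (-z)) atTop (𝓝 (1 + 0)) :=
    (tendsto_cdf_atTop _).add ((tendsto_cdf_atBot _).comp tendsto_neg_atTop_atBot)
  have h2 : Tendsto (fun _ : ℝ => Phi z + Phi (-z)) atTop (𝓝 (1 + 0)) :=
    hl.congr fun y => hc y z
  have := tendsto_nhds_unique tendsto_const_nhds h2
  linarith

theorem continuous_Phi : Continuous Phi :=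
  continuous_iff_continuousAt.2 fun z => (hasDerivAt_Phi z).continuousAt

theorem integrable_mul_phi : Integrable fun t => t * phi t := by
  have h := (integrable_mul_exp_neg_mul_sq (b := 1 / 2) (by norm_num)).const_mul
    (Real.sqrt (2 * Real.pi))⁻¹
  refine h.congr (ae_of_all _ fun t => ?_)
  simp only [phi_eq]
  rw [show -(1 / 2) * t ^ 2 = -(t ^ 2) / 2 by ring]
  ring

theorem integral_mul_phi (z : ℝ) : ∫ t in Set.Iic z, t * phi t = -phi z := by
  have h := integral_Iic_of_hasDerivAt_of_tendsto' (f := phi) (f' := fun t => -(t * phi t))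
    (a := z) (m := 0) (fun t _ => hasDerivAt_phi t) integrable_mul_phi.neg.integrableOn
    (tendsto_zero_of_hasDerivAt_of_integrableOn_Iic (a := z) (fun t _ => hasDerivAt_phi t)
      integrable_mul_phi.neg.integrableOn integrable_phi.integrableOn)
  rw [integral_neg] at h
  linarith

/-- The numerator of Mills' ratio inequality. -/
theorem mul_Phi_add_phi_pos (z : ℝ) : 0 < z * Phi z + phi z := by
  have hi : Integrable fun t => (z - t) * phi t := by
    simpa [sub_mul, Pi.sub_def] using (integrable_phi.const_mul z).sub integrable_mul_phi
  have e : z * Phi z + phi z = ∫ t in Set.Iic z, (z - t) * phi t := by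
    simp only [sub_mul]
    rw [integral_sub (integrable_phi.const_mul z).integrableOn integrable_mul_phi.integrableOn,
      integral_mul_phi, integral_const_mul, Phi_eq_integral]
    ring
  rw [e, setIntegral_pos_iff_support_of_nonneg_ae]
  · have : Set.Iio z ⊆ (Function.support fun t => (z - t) * phi t) ∩ Set.Iic z := fun t ht =>
      ⟨(mul_pos (sub_pos.2 ht) (phi_pos t)).ne', Set.Iio_subset_Iic_self ht⟩
    refine lt_of_lt_of_le ?_ (measure_mono this)
    simp
  · filter_upwards [ae_restrict_mem measurableSet_Iic] with t ht
    exact mul_nonneg (sub_nonneg.2 ht) (phi_pos t).le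
  · exact hi.integrableOn

/-- `(log Φ)' = φ / Φ`. -/
def score (z : ℝ) : ℝ := phi z / Phi z

/-- `-(log Φ)''`. -/
def curv (z : ℝ) : ℝ := score z * (z + score z)

/-- Information about the location in a probit observation. -/
def binInfo (z : ℝ) : ℝ := phi z ^ 2 / (Phi z * (1 - Phi z))

theorem hasDerivAt_logPhi (z : ℝ) : HasDerivAt (fun z => Real.log (Phi z)) (score z) z :=
  (hasDerivAt_Phi z).log (Phi_pos z).ne'

theorem hasDerivAt_score (z : ℝ) : HasDerivAt score (-curv z) z := by
  have h := (hasDerivAt_phi z).div (hasDerivAt_Phi z) (Phi_pos z).ne'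
  have hp := (Phi_pos z).ne'
  have e : (-(z * phi z) * Phi z - phi z * phi z) / Phi z ^ 2 = -curv z := by
    simp only [curv, score]
    field_simp
    ring
  rw [← e]
  exact h

theorem score_pos (z : ℝ) : 0 < score z := div_pos (phi_pos z) (Phi_pos z)

theorem curv_pos (z : ℝ) : 0 < curv z := by
  refine mul_pos (score_pos z) ?_
  have h := mul_Phi_add_phi_pos z
  have e : z + score z = (z * Phi z + phi z) / Phi z := by
    have hp := (Phi_pos z).ne'
    simp only [score]
    field_simp
  rw [e]
  exact div_pos h (Phi_pos z)

theorem contDiff_phi : ContDiff ℝ 1 phi := by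
  have e : phi = fun z : ℝ => (Real.sqrt (2 * Real.pi))⁻¹ * Real.exp (-(z ^ 2) / 2) :=
    funext phi_eq
  rw [e]
  fun_prop

theorem contDiff_Phi : ContDiff ℝ 1 Phi := by
  rw [contDiff_one_iff_deriv]
  refine ⟨fun z => (hasDerivAt_Phi z).differentiableAt, ?_⟩
  rw [show deriv Phi = phi from funext fun z => (hasDerivAt_Phi z).deriv]
  exact continuous_phi

theorem contDiff_score : ContDiff ℝ 1 score :=
  contDiff_phi.div contDiff_Phi fun z => (Phi_pos z).ne'

theorem contDiff_curv : ContDiff ℝ 1 curv := contDiff_score.mul (contDiff_id.add contDiff_score)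

theorem contDiff_binInfo : ContDiff ℝ 1 binInfo :=
  (contDiff_phi.pow 2).div (contDiff_Phi.mul (contDiff_const.sub contDiff_Phi)) fun z =>
    (mul_pos (Phi_pos z) (sub_pos.2 (Phi_lt_one z))).ne'

theorem binInfo_pos (z : ℝ) : 0 < binInfo z :=
  div_pos (pow_pos (phi_pos z) 2) (mul_pos (Phi_pos z) (sub_pos.2 (Phi_lt_one z)))

/-- Both outcomes together: the score has mean zero. -/
theorem mean_score (z : ℝ) : Phi z * score z - (1 - Phi z) * score (-z) = 0 := by
  have h1 := (Phi_pos z).ne'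
  have h2 := (sub_pos.2 (Phi_lt_one z)).ne'
  simp only [score, phi_neg, Phi_neg]
  field_simp
  ring

/-- Both outcomes together: the mean curvature is the information. -/
theorem mean_curv (z : ℝ) : Phi z * curv z + (1 - Phi z) * curv (-z) = binInfo z := by
  have h1 := (Phi_pos z).ne'
  have h2 := (sub_pos.2 (Phi_lt_one z)).ne'
  simp only [curv, score, phi_neg, Phi_neg, binInfo]
  field_simp
  ring

/-! ### Uniform Taylor bounds on compact sets -/

theorem exists_abs_le_of_continuous {f : ℝ → ℝ} (hf : Continuous f) (Z : ℝ) :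
    ∃ K, 0 < K ∧ ∀ z, |z| ≤ Z → |f z| ≤ K := by
  obtain ⟨K, hK⟩ := (isCompact_Icc (a := -Z) (b := Z)).exists_bound_of_continuousOn hf.continuousOn
  exact ⟨max K 1, by positivity, fun z hz => (hK z (abs_le.1 hz)).trans (le_max_left _ _)⟩

theorem exists_pos_le_of_continuous {f : ℝ → ℝ} (hf : Continuous f) (hp : ∀ z, 0 < f z) (Z : ℝ) :
    ∃ c, 0 < c ∧ ∀ z, |z| ≤ Z → c ≤ f z := by
  obtain ⟨K, hK, h⟩ := exists_abs_le_of_continuous (hf.inv₀ fun z => (hp z).ne') Z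
  refine ⟨K⁻¹, by positivity, fun z hz => ?_⟩
  have := (le_abs_self _).trans (h z hz)
  exact inv_le_of_inv_le₀ (hp z) this

theorem exists_lipschitz_of_contDiff {f : ℝ → ℝ} (hf : ContDiff ℝ 1 f) (Z : ℝ) :
    ∃ K, 0 < K ∧ ∀ z w, |z| ≤ Z → |w| ≤ Z → |f z - f w| ≤ K * |z - w| := by
  obtain ⟨K, hK, h⟩ := exists_abs_le_of_continuous (hf.continuous_deriv le_rfl) Z
  refine ⟨K, hK, fun z w hz hw => ?_⟩
  exact (convex_Icc (-Z) Z).norm_image_sub_le_of_norm_deriv_le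
    (fun x _ => (hf.differentiable one_ne_zero).differentiableAt)
    (fun x hx => h x (abs_le.2 hx)) (abs_le.1 hw) (abs_le.1 hz)

/-- A bound for the second derivative on a segment bounds the first Taylor remainder. -/
theorem taylor_le {f f' f'' : ℝ → ℝ} (h1 : ∀ z, HasDerivAt f (f' z) z)
    (h2 : ∀ z, HasDerivAt f' (f'' z) z) {z y M : ℝ}
    (hM : ∀ s ∈ Set.Icc (0 : ℝ) 1, f'' (z + s * y) ≤ M) :
    f (z + y) - f z - f' z * y ≤ M * y ^ 2 / 2 := by
  have hl : ∀ s : ℝ, HasDerivAt (fun s : ℝ => z + s * y) y s := fun s => by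
    simpa using ((hasDerivAt_id s).mul_const y).const_add z
  have hp1 : ∀ s, HasDerivAt (fun s => f (z + s * y)) (f' (z + s * y) * y) s := fun s =>
    (h1 _).comp s (hl s)
  have hp2 : ∀ s, HasDerivAt (fun s => f' (z + s * y) * y) (f'' (z + s * y) * y * y) s := fun s =>
    ((h2 _).comp s (hl s)).mul_const y
  have m1 : MonotoneOn (fun s => M * y ^ 2 * s - f' (z + s * y) * y) (Set.Icc 0 1) := by
    have hd : ∀ s, HasDerivAt (fun s => M * y ^ 2 * s - f' (z + s * y) * y)
        (M * y ^ 2 - f'' (z + s * y) * y * y) s := fun s => by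
      simpa using ((hasDerivAt_id s).const_mul (M * y ^ 2)).fun_sub (hp2 s)
    refine monotoneOn_of_deriv_nonneg (convex_Icc 0 1)
      (fun s _ => (hd s).continuousAt.continuousWithinAt)
      (fun s _ => (hd s).differentiableAt.differentiableWithinAt) fun s hs => ?_
    rw [(hd s).deriv]
    nlinarith [hM s (interior_subset hs), sq_nonneg y]
  have m2 : MonotoneOn (fun s => M * y ^ 2 * (s ^ 2 / 2) + f' z * y * s - f (z + s * y))
      (Set.Icc 0 1) := by
    have hd : ∀ s, HasDerivAt (fun s => M * y ^ 2 * (s ^ 2 / 2) + f' z * y * s - f (z + s * y))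
        (M * y ^ 2 * s + f' z * y - f' (z + s * y) * y) s := fun s => by
      have hq : HasDerivAt (fun s : ℝ => s ^ 2 / 2) s s := by
        simpa using (hasDerivAt_pow 2 s).div_const 2
      simpa using ((hq.const_mul (M * y ^ 2)).fun_add
        ((hasDerivAt_id s).const_mul (f' z * y))).fun_sub (hp1 s)
    refine monotoneOn_of_deriv_nonneg (convex_Icc 0 1)
      (fun s _ => (hd s).continuousAt.continuousWithinAt)
      (fun s _ => (hd s).differentiableAt.differentiableWithinAt) fun s hs => ?_
    rw [(hd s).deriv]
    have := m1 (Set.left_mem_Icc.2 zero_le_one) (interior_subset hs) (interior_subset hs).1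
    simp only [mul_zero, zero_mul, add_zero] at this
    linarith
  have := m2 (Set.left_mem_Icc.2 zero_le_one) (Set.right_mem_Icc.2 zero_le_one) zero_le_one
  simp only [mul_one, one_mul, mul_zero, zero_mul, add_zero] at this
  linarith

theorem le_taylor {f f' f'' : ℝ → ℝ} (h1 : ∀ z, HasDerivAt f (f' z) z)
    (h2 : ∀ z, HasDerivAt f' (f'' z) z) {z y M : ℝ}
    (hM : ∀ s ∈ Set.Icc (0 : ℝ) 1, M ≤ f'' (z + s * y)) :
    M * y ^ 2 / 2 ≤ f (z + y) - f z - f' z * y := by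
  have := taylor_le (f := -f) (f' := -f') (f'' := -f'') (z := z) (y := y) (M := -M)
    (fun z => (h1 z).neg) (fun z => (h2 z).neg) fun s hs => by simpa using hM s hs
  simp only [Pi.neg_apply] at this
  linarith

/-- The first Taylor remainder of `log Φ` at `z` for the increment `y`. -/
def logPhiRem (z y : ℝ) : ℝ := Real.log (Phi (z + y)) - Real.log (Phi z) - score z * y

theorem logPhiRem_nonpos (z y : ℝ) : logPhiRem z y ≤ 0 := by
  have := taylor_le (z := z) (y := y) (M := 0) hasDerivAt_logPhi hasDerivAt_score
    fun s _ => by linarith [curv_pos (z + s * y)]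
  simpa [logPhiRem] using this

theorem concaveOn_logPhi : ConcaveOn ℝ Set.univ fun z => Real.log (Phi z) := by
  refine ⟨convex_univ, fun x _ y _ a b ha hb hab => ?_⟩
  set w := a * x + b * y
  have h1 := logPhiRem_nonpos w (x - w)
  have h2 := logPhiRem_nonpos w (y - w)
  simp only [logPhiRem, add_sub_cancel] at h1 h2
  simp only [smul_eq_mul]
  have e : a * (score w * (x - w)) + b * (score w * (y - w)) = 0 := by
    have : a * (x - w) + b * (y - w) = 0 := by
      have : a * (x - w) + b * (y - w) = a * x + b * y - (a + b) * w := by ring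
      rw [this, hab]; ring
    linear_combination score w * this
  have e2 : (a + b) * Real.log (Phi w) = Real.log (Phi w) := by rw [hab, one_mul]
  have := mul_le_mul_of_nonneg_left h1 ha
  have := mul_le_mul_of_nonneg_left h2 hb
  nlinarith

/-- The minimum of a quadratic and a linear growth. -/
def hub (y : ℝ) : ℝ := min (y ^ 2) |y|

theorem hub_nonneg (y : ℝ) : 0 ≤ hub y := le_min (sq_nonneg y) (abs_nonneg y)

theorem abs_add_mul_le {z y s Z : ℝ} (hz : |z| ≤ Z) (hy : |y| ≤ Z) (hs : s ∈ Set.Icc (0 : ℝ) 1) :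
    |z + s * y| ≤ 2 * Z := by
  have : |s * y| ≤ |y| := by
    rw [abs_mul, abs_of_nonneg hs.1]
    exact mul_le_of_le_one_left (abs_nonneg y) hs.2
  linarith [abs_add_le z (s * y)]

theorem exists_logPhiRem_le (Z : ℝ) :
    ∃ c, 0 < c ∧ ∀ z y, |z| ≤ Z → logPhiRem z y ≤ -c * hub y := by
  obtain ⟨c, hc, h⟩ := exists_pos_le_of_continuous contDiff_curv.continuous curv_pos
    (2 * max Z 1)
  have key : ∀ z y, |z| ≤ Z → |y| ≤ 1 → logPhiRem z y ≤ -(c / 2) * y ^ 2 := fun z y hz hy => by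
    have := taylor_le (z := z) (y := y) (M := -c) hasDerivAt_logPhi hasDerivAt_score
      fun s hs => neg_le_neg (h _ (abs_add_mul_le (hz.trans (le_max_left _ _))
        (hy.trans (le_max_right _ _)) hs))
    simp only [logPhiRem]
    linarith
  refine ⟨c / 2, by positivity, fun z y hz => ?_⟩
  rcases le_total |y| 1 with hy | hy
  · refine (key z y hz hy).trans ?_
    have : hub y ≤ y ^ 2 := min_le_left _ _
    nlinarith
  · have hy0 : 0 < |y| := by linarith
    have hu := key z (y / |y|) hz (by rw [abs_div, abs_abs, div_self hy0.ne'])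
    have hsq : (y / |y|) ^ 2 = 1 := by rw [div_pow, sq_abs, div_self]; simpa using hy0.ne'
    have hcc := concaveOn_logPhi.2
    have hconc := hcc (Set.mem_univ (z + y)) (Set.mem_univ z)
      (a := 1 / |y|) (b := 1 - 1 / |y|) (by positivity)
      (sub_nonneg.2 ((div_le_one hy0).2 hy)) (by ring)
    have e : (1 / |y|) • (z + y) + (1 - 1 / |y|) • z = z + y / |y| := by
      simp only [smul_eq_mul]; ring
    rw [e] at hconc
    simp only [smul_eq_mul] at hconc
    have h3 : logPhiRem z y / |y| ≤ logPhiRem z (y / |y|) := by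
      simp only [logPhiRem]
      have : (Real.log (Phi (z + y)) - Real.log (Phi z) - score z * y) / |y|
        = 1 / |y| * Real.log (Phi (z + y)) + (1 - 1 / |y|) * Real.log (Phi z)
          - Real.log (Phi z) - score z * (y / |y|) := by ring
      rw [this]
      linarith
    have h4 : logPhiRem z y / |y| ≤ -(c / 2) := by
      refine h3.trans (hu.trans ?_)
      rw [hsq, mul_one]
    rw [div_le_iff₀ hy0] at h4
    have : hub y ≤ |y| := min_le_right _ _
    nlinarith

theorem exists_abs_logPhiRem_add_le (Z : ℝ) :
    ∃ K, 0 < K ∧ ∀ z y, |z| ≤ Z → |y| ≤ Z →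
      |logPhiRem z y + curv z * y ^ 2 / 2| ≤ K * |y| ^ 3 := by
  obtain ⟨K, hK, h⟩ := exists_lipschitz_of_contDiff contDiff_curv (2 * Z)
  refine ⟨K, hK, fun z y hz hy => ?_⟩
  have hd : ∀ s ∈ Set.Icc (0 : ℝ) 1, |curv (z + s * y) - curv z| ≤ K * |y| := fun s hs => by
    refine (h _ _ (abs_add_mul_le hz hy hs) (by linarith [abs_nonneg z])).trans ?_
    rw [add_sub_cancel_left, abs_mul, abs_of_nonneg hs.1]
    exact mul_le_mul_of_nonneg_left (mul_le_of_le_one_left (abs_nonneg y) hs.2) hK.le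
  have h1 := taylor_le (z := z) (y := y) (M := -curv z + K * |y|) hasDerivAt_logPhi
    hasDerivAt_score fun s hs => by linarith [(abs_le.1 (hd s hs)).1]
  have h2 := le_taylor (z := z) (y := y) (M := -curv z - K * |y|) hasDerivAt_logPhi
    hasDerivAt_score fun s hs => by linarith [(abs_le.1 (hd s hs)).2]
  have e : K * |y| ^ 3 = K * |y| * y ^ 2 := by rw [← sq_abs y]; ring
  have : 0 ≤ K * |y| * y ^ 2 := by positivity
  rw [e, abs_le]
  simp only [logPhiRem]
  constructor <;> nlinarith

theorem exists_le_logPhiRem (Z : ℝ) :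
    ∃ K, 0 < K ∧ ∀ z y, |z| ≤ Z → |y| ≤ Z → -K * y ^ 2 ≤ logPhiRem z y := by
  obtain ⟨K, hK, h⟩ := exists_abs_le_of_continuous contDiff_curv.continuous (2 * Z)
  refine ⟨K / 2, by positivity, fun z y hz hy => ?_⟩
  have := le_taylor (z := z) (y := y) (M := -K) hasDerivAt_logPhi hasDerivAt_score
    fun s hs => neg_le_neg ((le_abs_self _).trans (h _ (abs_add_mul_le hz hy hs)))
  simp only [logPhiRem]
  linarith

theorem hasDerivAt_logPhiRem_zero (z : ℝ) : HasDerivAt (logPhiRem z) 0 0 := by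
  have h1 : HasDerivAt (fun y : ℝ => Real.log (Phi (z + y))) (score z) 0 := by
    have := (hasDerivAt_logPhi (z + 0)).comp_const_add z 0
    simpa using this
  have := (h1.sub_const (Real.log (Phi z))).fun_sub ((hasDerivAt_id (0 : ℝ)).const_mul (score z))
  rw [mul_one, sub_self] at this
  exact this

/-- The sign of an outcome. -/
def sgn (r : Bool) : ℝ := if r then 1 else -1

theorem sgn_sq (r : Bool) : sgn r ^ 2 = 1 := by cases r <;> simp [sgn]

theorem abs_sgn (r : Bool) : |sgn r| = 1 := by cases r <;> simp [sgn]

namespace Params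

variable (m : Params)

/-- The signed argument of `Φ` in the likelihood of an accuracy. -/
def arg (j : ℕ) (r : Bool) (θ : ℝ) : ℝ := sgn r * (m.a j * θ + m.b j)

theorem accLik_eq (j : ℕ) (r : Bool) (θ : ℝ) : m.accLik j r θ = Phi (m.arg j r θ) := by
  cases r <;> simp [accLik, arg, sgn, ← Phi_neg]

theorem arg_add (j : ℕ) (r : Bool) (θ y : ℝ) :
    m.arg j r (θ + y) = m.arg j r θ + sgn r * m.a j * y := by
  simp only [arg]; ring

theorem abs_arg (j : ℕ) (r : Bool) (θ : ℝ) : |m.arg j r θ| = |m.a j * θ + m.b j| := by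
  rw [arg, abs_mul, abs_sgn, one_mul]

theorem lam_pos' (j : ℕ) : (0 : ℝ) < m.lam j := m.lam_pos j

theorem log_cotLik (j : ℕ) {t : ℝ} (ht : 0 < t) (τ : ℝ) :
    Real.log (m.cotLik j t τ) = -Real.log (Real.sqrt (2 * Real.pi * m.lam j)) - Real.log t
      - (Real.log t - m.omega j + m.vphi j * τ) ^ 2 / (2 * m.lam j) := by
  have hl := m.lam_pos' j
  have hs : Real.sqrt (2 * Real.pi * m.lam j) ≠ 0 := by positivity
  rw [cotLik, gaussianPDFReal, Real.log_div (by positivity) ht.ne',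
    Real.log_mul (by positivity) (Real.exp_ne_zero _), Real.log_exp, Real.log_inv]
  ring

theorem cotLik_pos (j : ℕ) {t : ℝ} (ht : 0 < t) (τ : ℝ) : 0 < m.cotLik j t τ :=
  div_pos (gaussianPDFReal_pos _ _ _ (m.lam_pos j).ne') ht

theorem accLik_pos (j : ℕ) (r : Bool) (θ : ℝ) : 0 < m.accLik j r θ := by
  rw [accLik_eq]; exact Phi_pos _

/-- Information about `τ` in one CoT length. -/
def cotInfo (j : ℕ) : ℝ := m.vphi j ^ 2 / m.lam j

theorem cotInfo_nonneg (j : ℕ) : 0 ≤ m.cotInfo j := div_nonneg (sq_nonneg _) (m.lam_pos' j).le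

/-- Derivative in `θ` of the log likelihood of an accuracy. -/
def accScore (j : ℕ) (r : Bool) (θ : ℝ) : ℝ := sgn r * m.a j * score (m.arg j r θ)

/-- Derivative in `τ` of the log likelihood of a CoT length. -/
def cotScore (j : ℕ) (t τ : ℝ) : ℝ :=
  -(m.vphi j / m.lam j) * (Real.log t - m.omega j + m.vphi j * τ)

/-- Minus the second derivative in `θ` of the log likelihood of an accuracy. -/
def accCurv (j : ℕ) (r : Bool) (θ : ℝ) : ℝ := m.a j ^ 2 * curv (m.arg j r θ)

/-- First Taylor remainder in `θ` of the log likelihood of an accuracy. -/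
def accRem (j : ℕ) (r : Bool) (θ y : ℝ) : ℝ := logPhiRem (m.arg j r θ) (sgn r * m.a j * y)

theorem accInfo_eq (j : ℕ) (θ : ℝ) :
    m.accInfo j θ = m.a j ^ 2 * binInfo (m.a j * θ + m.b j) := by
  simp only [accInfo, binInfo]; ring

/-- The data are admissible up to item `J`: all CoT lengths are positive. -/
def Admissible (J : ℕ) (x : Data) : Prop := ∀ j < J, 0 < (x j).2

theorem log_accLik_add (j : ℕ) (r : Bool) (θ y : ℝ) :
    Real.log (m.accLik j r (θ + y)) - Real.log (m.accLik j r θ)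
      = m.accRem j r θ y + m.accScore j r θ * y := by
  simp only [accLik_eq, arg_add, accRem, logPhiRem, accScore]; ring

theorem log_cotLik_add (j : ℕ) {t : ℝ} (ht : 0 < t) (τ y : ℝ) :
    Real.log (m.cotLik j t (τ + y)) - Real.log (m.cotLik j t τ)
      = m.cotScore j t τ * y - m.cotInfo j * y ^ 2 / 2 := by
  have hl := (m.lam_pos' j).ne'
  simp only [m.log_cotLik j ht, cotScore, cotInfo]
  field_simp
  ring

theorem logLik_add {J : ℕ} {x : Data} (hx : Admissible J x) (ξ v : Trait) :
    m.logLik J x (ξ + v) - m.logLik J x ξ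
      = ∑ j ∈ Finset.range J, m.accRem j (x j).1 (ξ 0) (v 0)
        + (∑ j ∈ Finset.range J, m.accScore j (x j).1 (ξ 0)) * v 0
        + (∑ j ∈ Finset.range J, m.cotScore j (x j).2 (ξ 1)) * v 1
        - (∑ j ∈ Finset.range J, m.cotInfo j) * v 1 ^ 2 / 2 := by
  simp only [logLik, Finset.sum_mul, Finset.sum_div]
  rw [← Finset.sum_sub_distrib, ← Finset.sum_add_distrib, ← Finset.sum_add_distrib,
    ← Finset.sum_sub_distrib]
  refine Finset.sum_congr rfl fun j hj => ?_
  have h1 := m.log_accLik_add j (x j).1 (ξ 0) (v 0)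
  have h2 := m.log_cotLik_add j (hx j (Finset.mem_range.1 hj)) (ξ 1) (v 1)
  simp only [Pi.add_apply]
  linarith

theorem lik_eq_exp {J : ℕ} {x : Data} (hx : Admissible J x) (ξ : Trait) :
    m.lik J x ξ = Real.exp (m.logLik J x ξ) := by
  rw [lik, logLik, Real.exp_sum]
  refine Finset.prod_congr rfl fun j hj => ?_
  rw [Real.exp_add, Real.exp_log (m.accLik_pos _ _ _),
    Real.exp_log (m.cotLik_pos _ (hx j (Finset.mem_range.1 hj)) _)]

theorem one_sub_rho_sq_pos (hρ : |m.rho| < 1) : 0 < 1 - m.rho ^ 2 := by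
  have := (sq_lt_one_iff_abs_lt_one m.rho).2 hρ
  linarith

theorem Sigma_inv (hρ : |m.rho| < 1) : m.Sigma⁻¹ =
    !![1 / (1 - m.rho ^ 2), -m.rho / (1 - m.rho ^ 2);
      -m.rho / (1 - m.rho ^ 2), 1 / (1 - m.rho ^ 2)] := by
  have h := (m.one_sub_rho_sq_pos hρ).ne'
  refine Matrix.inv_eq_left_inv ?_
  ext i k
  fin_cases i <;> fin_cases k <;> simp [Sigma, Matrix.mul_apply, Fin.sum_univ_two] <;>
    field_simp <;> ring

theorem quad_eq (hρ : |m.rho| < 1) (ξ : Trait) :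
    m.quad ξ = (ξ 0 ^ 2 - 2 * m.rho * ξ 0 * ξ 1 + ξ 1 ^ 2) / (1 - m.rho ^ 2) := by
  rw [quad, m.Sigma_inv hρ]
  simp [dotProduct, Matrix.mulVec, Fin.sum_univ_two]
  ring

theorem le_quad (hρ : |m.rho| < 1) (ξ : Trait) : (ξ 0 ^ 2 + ξ 1 ^ 2) / 2 ≤ m.quad ξ := by
  rw [m.quad_eq hρ, le_div_iff₀ (m.one_sub_rho_sq_pos hρ)]
  obtain ⟨h1, h2⟩ := abs_lt.1 hρ
  nlinarith [mul_nonneg (sub_nonneg.2 h2.le) (sq_nonneg (ξ 0 + ξ 1)),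
    mul_nonneg (by linarith : 0 ≤ 1 + m.rho) (sq_nonneg (ξ 0 - ξ 1)),
    mul_nonneg (sq_nonneg m.rho) (add_nonneg (sq_nonneg (ξ 0)) (sq_nonneg (ξ 1)))]

theorem quad_nonneg (hρ : |m.rho| < 1) (ξ : Trait) : 0 ≤ m.quad ξ :=
  le_trans (by positivity) (m.le_quad hρ ξ)

/-- The components of `Σ⁻¹ ξ`. -/
def priorGrad (ξ : Trait) : Trait :=
  ![(ξ 0 - m.rho * ξ 1) / (1 - m.rho ^ 2), (ξ 1 - m.rho * ξ 0) / (1 - m.rho ^ 2)]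

/-- The gradient of the log posterior. -/
def postScore (J : ℕ) (x : Data) (ξ : Trait) : Trait :=
  ![∑ j ∈ Finset.range J, m.accScore j (x j).1 (ξ 0), ∑ j ∈ Finset.range J,
    m.cotScore j (x j).2 (ξ 1)] - m.priorGrad ξ

theorem logPost_add (hρ : |m.rho| < 1) {J : ℕ} {x : Data} (hx : Admissible J x) (ξ v : Trait) :
    m.logPost J x (ξ + v) - m.logPost J x ξ
      = ∑ j ∈ Finset.range J, m.accRem j (x j).1 (ξ 0) (v 0)
        + m.postScore J x ξ 0 * v 0 + m.postScore J x ξ 1 * v 1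
        - (∑ j ∈ Finset.range J, m.cotInfo j) * v 1 ^ 2 / 2 - m.quad v / 2 := by
  have h := m.logLik_add hx ξ v
  have hr := (m.one_sub_rho_sq_pos hρ).ne'
  have hq : m.quad (ξ + v) - m.quad ξ
      = m.quad v + 2 * (m.priorGrad ξ 0 * v 0 + m.priorGrad ξ 1 * v 1) := by
    simp only [m.quad_eq hρ, priorGrad, Pi.add_apply, Matrix.cons_val_zero, Matrix.cons_val_one]
    field_simp
    ring
  simp only [logPost, postScore, Pi.sub_apply, Matrix.cons_val_zero, Matrix.cons_val_one]
  linarith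

theorem accRem_nonpos (j : ℕ) (r : Bool) (θ y : ℝ) : m.accRem j r θ y ≤ 0 := logPhiRem_nonpos _ _

theorem hasDerivAt_accRem_zero (j : ℕ) (r : Bool) (θ : ℝ) : HasDerivAt (m.accRem j r θ) 0 0 := by
  have h1 : HasDerivAt (fun y : ℝ => sgn r * m.a j * y) (sgn r * m.a j) 0 := by
    simpa using (hasDerivAt_id (0 : ℝ)).const_mul (sgn r * m.a j)
  have h2 : HasDerivAt (logPhiRem (m.arg j r θ)) 0 (sgn r * m.a j * 0) := by
    simpa using hasDerivAt_logPhiRem_zero (m.arg j r θ)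
  have h := h2.comp (0 : ℝ) h1
  rw [zero_mul] at h
  exact h

theorem quad_smul (t : ℝ) (v : Trait) : m.quad (t • v) = t ^ 2 * m.quad v := by
  simp only [quad, Matrix.mulVec_smul, dotProduct_smul, smul_dotProduct, smul_eq_mul]
  ring

theorem hasLineDerivAt_logPost (hρ : |m.rho| < 1) {J : ℕ} {x : Data} (hx : Admissible J x)
    (ξ : Trait) (i : Fin 2) :
    HasLineDerivAt ℝ (m.logPost J x) (m.postScore J x ξ i) ξ (Pi.single i 1) := by
  have e : ∀ t : ℝ, m.logPost J x (ξ + t • Pi.single i 1)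
      = m.logPost J x ξ + (∑ j ∈ Finset.range J,
          m.accRem j (x j).1 (ξ 0) (t * (Pi.single i 1 : Trait) 0)
        + t * m.postScore J x ξ i
        - t ^ 2 * ((∑ j ∈ Finset.range J, m.cotInfo j) * (Pi.single i 1 : Trait) 1 ^ 2 / 2
          + m.quad (Pi.single i 1) / 2)) := fun t => by
    have h := m.logPost_add hρ hx ξ (t • Pi.single i 1)
    rw [m.quad_smul] at h
    have hs : m.postScore J x ξ 0 * (t • (Pi.single i 1 : Trait)) 0
        + m.postScore J x ξ 1 * (t • (Pi.single i 1 : Trait)) 1 = t * m.postScore J x ξ i := by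
      fin_cases i <;> simp [mul_comm]
    simp only [Pi.smul_apply, smul_eq_mul] at h hs
    linarith
  unfold HasLineDerivAt
  simp only [e]
  have h1 : HasDerivAt (fun t : ℝ => ∑ j ∈ Finset.range J,
      m.accRem j (x j).1 (ξ 0) (t * (Pi.single i 1 : Trait) 0)) 0 0 := by
    have : ∀ j ∈ Finset.range J, HasDerivAt (fun t : ℝ =>
        m.accRem j (x j).1 (ξ 0) (t * (Pi.single i 1 : Trait) 0)) 0 0 := fun j _ => by
      have ha : HasDerivAt (fun t : ℝ => t * (Pi.single i 1 : Trait) 0)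
          ((Pi.single i 1 : Trait) 0) 0 := by
        simpa using (hasDerivAt_id (0 : ℝ)).mul_const ((Pi.single i 1 : Trait) 0)
      have hb : HasDerivAt (m.accRem j (x j).1 (ξ 0)) 0 (0 * (Pi.single i 1 : Trait) 0) := by
        simpa using m.hasDerivAt_accRem_zero j (x j).1 (ξ 0)
      have h := hb.comp (0 : ℝ) ha
      rw [zero_mul] at h
      exact h
    simpa using HasDerivAt.fun_sum this
  have h2 : HasDerivAt (fun t : ℝ => t * m.postScore J x ξ i) (m.postScore J x ξ i) 0 := by
    simpa using (hasDerivAt_id (0 : ℝ)).mul_const (m.postScore J x ξ i)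
  have h3 : ∀ C : ℝ, HasDerivAt (fun t : ℝ => t ^ 2 * C) 0 0 := fun C => by
    simpa using (hasDerivAt_pow 2 (0 : ℝ)).mul_const C
  simpa using ((h1.fun_add h2).fun_sub (h3 _)).const_add (m.logPost J x ξ)

/-- First order condition. -/
theorem postScore_eq_zero (hρ : |m.rho| < 1) {J : ℕ} {x : Data} (hx : Admissible J x) {ξ : Trait}
    (hξ : ∀ η, m.logPost J x η ≤ m.logPost J x ξ) : m.postScore J x ξ = 0 := by
  funext i
  have h := m.hasLineDerivAt_logPost hρ hx ξ i
  refine IsLocalMax.hasDerivAt_eq_zero (Eventually.of_forall fun t => ?_) h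
  simpa using hξ _

theorem logPost_add_of_isMax (hρ : |m.rho| < 1) {J : ℕ} {x : Data} (hx : Admissible J x) {ξ : Trait}
    (hξ : ∀ η, m.logPost J x η ≤ m.logPost J x ξ) (v : Trait) :
    m.logPost J x (ξ + v) - m.logPost J x ξ
      = ∑ j ∈ Finset.range J, m.accRem j (x j).1 (ξ 0) (v 0)
        - (∑ j ∈ Finset.range J, m.cotInfo j) * v 1 ^ 2 / 2 - m.quad v / 2 := by
  rw [m.logPost_add hρ hx, m.postScore_eq_zero hρ hx hξ]
  simp

theorem logPost_le_quadratic (hρ : |m.rho| < 1) {J : ℕ} {x : Data} (hx : Admissible J x)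
    (ξ v : Trait) :
    m.logPost J x (ξ + v) - m.logPost J x ξ
      ≤ m.postScore J x ξ 0 * v 0 + m.postScore J x ξ 1 * v 1 - (v 0 ^ 2 + v 1 ^ 2) / 4 := by
  rw [m.logPost_add hρ hx]
  have h1 : ∑ j ∈ Finset.range J, m.accRem j (x j).1 (ξ 0) (v 0) ≤ 0 :=
    Finset.sum_nonpos fun j _ => m.accRem_nonpos _ _ _ _
  have h2 : 0 ≤ (∑ j ∈ Finset.range J, m.cotInfo j) * v 1 ^ 2 :=
    mul_nonneg (Finset.sum_nonneg fun j _ => m.cotInfo_nonneg j) (sq_nonneg _)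
  have h3 := m.le_quad hρ v
  linarith

theorem continuous_log_Phi : Continuous fun z => Real.log (Phi z) :=
  continuous_Phi.log fun z => (Phi_pos z).ne'

theorem continuous_logLik {J : ℕ} {x : Data} (hx : Admissible J x) :
    Continuous (m.logLik J x) := by
  unfold logLik
  refine continuous_finsetSum _ fun j hj => Continuous.add ?_ ?_
  · simp only [accLik_eq, arg]
    exact continuous_log_Phi.comp (by fun_prop)
  · simp only [m.log_cotLik j (hx j (Finset.mem_range.1 hj))]
    fun_prop

theorem continuous_quad (hρ : |m.rho| < 1) : Continuous m.quad := by
  rw [show m.quad = _ from funext (m.quad_eq hρ)]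
  fun_prop

theorem continuous_logPost (hρ : |m.rho| < 1) {J : ℕ} {x : Data} (hx : Admissible J x) :
    Continuous (m.logPost J x) :=
  (m.continuous_logLik hx).sub ((m.continuous_quad hρ).const_mul _)

theorem norm_sq_le (v : Trait) : ‖v‖ ^ 2 ≤ v 0 ^ 2 + v 1 ^ 2 := by
  have h : ‖v‖ ≤ max |v 0| |v 1| := by
    refine (pi_norm_le_iff_of_nonneg (by positivity)).2 fun i => ?_
    fin_cases i
    · exact le_max_left _ _
    · exact le_max_right _ _
  refine (pow_le_pow_left₀ (norm_nonneg _) h 2).trans ?_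
  rcases max_choice |v 0| |v 1| with h | h <;> rw [h, sq_abs] <;>
    nlinarith [sq_nonneg (v 0), sq_nonneg (v 1)]

theorem existsUnique_mode (hρ : |m.rho| < 1) {J : ℕ} {x : Data} (hx : Admissible J x) :
    ∃! ξ : Trait, ∀ η, m.logPost J x η ≤ m.logPost J x ξ := by
  obtain ⟨ξ, hξ⟩ : ∃ ξ : Trait, ∀ η, m.logPost J x η ≤ m.logPost J x ξ := by
    refine (m.continuous_logPost hρ hx).exists_forall_ge' 0 ?_
    set S := |m.postScore J x 0 0| + |m.postScore J x 0 1|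
    filter_upwards [tendsto_norm_cocompact_atTop.eventually_ge_atTop (4 * S)] with η hη
    have h := m.logPost_le_quadratic hρ hx 0 η
    rw [zero_add] at h
    have h0 : |η 0| ≤ ‖η‖ := norm_le_pi_norm η 0
    have h1 : |η 1| ≤ ‖η‖ := norm_le_pi_norm η 1
    have e0 : m.postScore J x 0 0 * η 0 ≤ |m.postScore J x 0 0| * ‖η‖ := by
      refine (le_abs_self _).trans ?_
      rw [abs_mul]
      exact mul_le_mul_of_nonneg_left h0 (abs_nonneg _)
    have e1 : m.postScore J x 0 1 * η 1 ≤ |m.postScore J x 0 1| * ‖η‖ := by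
      refine (le_abs_self _).trans ?_
      rw [abs_mul]
      exact mul_le_mul_of_nonneg_left h1 (abs_nonneg _)
    have e2 := norm_sq_le η
    have : 4 * S * ‖η‖ ≤ ‖η‖ * ‖η‖ := mul_le_mul_of_nonneg_right hη (norm_nonneg _)
    simp only [S] at this
    nlinarith
  refine ⟨ξ, hξ, fun η hη => ?_⟩
  have h := m.logPost_le_quadratic hρ hx ξ (η - ξ)
  rw [m.postScore_eq_zero hρ hx hξ, add_sub_cancel] at h
  have h2 := hη ξ
  simp only [Pi.zero_apply, zero_mul, zero_add] at h
  have h3 := norm_sq_le (η - ξ)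
  have h4 : ‖η - ξ‖ ^ 2 ≤ 0 := by linarith
  have h5 : ‖η - ξ‖ = 0 := by
    nlinarith [norm_nonneg (η - ξ)]
  exact sub_eq_zero.1 (norm_eq_zero.1 h5)

theorem mode_isMax (hρ : |m.rho| < 1) {J : ℕ} {x : Data} (hx : Admissible J x) (η : Trait) :
    m.logPost J x η ≤ m.logPost J x (m.mode J x) :=
  Classical.epsilon_spec (m.existsUnique_mode hρ hx).exists η

/-! ### Marginals of the data law and the posterior information -/

theorem measurable_acc (j : ℕ) : Measurable fun x : Data => (x j).1 :=
  measurable_fst.comp (measurable_pi_apply j)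

theorem measurable_cot (j : ℕ) : Measurable fun x : Data => (x j).2 :=
  measurable_snd.comp (measurable_pi_apply j)

theorem map_eval_dataLaw (ξ : Trait) (j : ℕ) :
    (m.dataLaw ξ).map (fun x => x j) = (m.accLaw j (ξ 0)).prod (m.cotLaw j (ξ 1)) :=
  Measure.infinitePi_map_eval _ j

theorem map_fst_dataLaw (ξ : Trait) (j : ℕ) :
    (m.dataLaw ξ).map (fun x => (x j).1) = m.accLaw j (ξ 0) := by
  have h := Measure.map_map (μ := m.dataLaw ξ) (f := fun x : Data => x j) (g := Prod.fst)
    measurable_fst (measurable_pi_apply j)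
  rw [map_eval_dataLaw, Measure.map_fst_prod, measure_univ, one_smul] at h
  exact h.symm

theorem map_snd_dataLaw (ξ : Trait) (j : ℕ) :
    (m.dataLaw ξ).map (fun x => (x j).2) = m.cotLaw j (ξ 1) := by
  have h := Measure.map_map (μ := m.dataLaw ξ) (f := fun x : Data => x j) (g := Prod.snd)
    measurable_snd (measurable_pi_apply j)
  rw [map_eval_dataLaw, Measure.map_snd_prod, measure_univ, one_smul] at h
  exact h.symm

theorem map_log_dataLaw (ξ : Trait) (j : ℕ) :
    (m.dataLaw ξ).map (fun x => Real.log (x j).2)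
      = gaussianReal (m.omega j - m.vphi j * ξ 1) (m.lam j) := by
  have h := Measure.map_map (μ := m.dataLaw ξ) (f := fun x : Data => (x j).2) (g := Real.log)
    Real.measurable_log (measurable_cot j)
  rw [map_snd_dataLaw, cotLaw, Measure.map_map Real.measurable_log Real.measurable_exp] at h
  have e : Real.log ∘ Real.exp = id := funext Real.log_exp
  rw [e, Measure.map_id] at h
  exact h.symm

theorem ae_pos (ξ : Trait) : ∀ᵐ x ∂(m.dataLaw ξ), ∀ j, 0 < (x j).2 := by
  rw [ae_all_iff]
  intro j
  have h : ∀ᵐ t ∂((m.dataLaw ξ).map fun x => (x j).2), 0 < t := by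
    rw [map_snd_dataLaw, cotLaw, ae_map_iff Real.measurable_exp.aemeasurable measurableSet_Ioi]
    exact ae_of_all _ Real.exp_pos
  exact ae_of_ae_map (measurable_cot j).aemeasurable h

theorem ae_admissible (ξ : Trait) (J : ℕ) : ∀ᵐ x ∂(m.dataLaw ξ), Admissible J x := by
  filter_upwards [m.ae_pos ξ] with x hx j _ using hx j

theorem integral_acc (ξ : Trait) (j : ℕ) (f : Bool → ℝ) :
    ∫ x, f (x j).1 ∂(m.dataLaw ξ)
      = Phi (m.a j * ξ 0 + m.b j) * f true + (1 - Phi (m.a j * ξ 0 + m.b j)) * f false := by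
  have hm : AEStronglyMeasurable f ((m.dataLaw ξ).map fun x => (x j).1) :=
    (measurable_of_finite f).aestronglyMeasurable
  rw [← integral_map (φ := fun x : Data => (x j).1) (measurable_acc j).aemeasurable hm,
    map_fst_dataLaw, accLaw, integral_add_measure, integral_smul_measure, integral_smul_measure, integral_dirac,
    integral_dirac, ENNReal.toReal_ofReal (Phi_pos _).le,
    ENNReal.toReal_ofReal (sub_nonneg.2 (Phi_lt_one _).le), smul_eq_mul, smul_eq_mul]
  · exact (integrable_dirac (by simp)).smul_measure ENNReal.ofReal_ne_top
  · exact (integrable_dirac (by simp)).smul_measure ENNReal.ofReal_ne_top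

theorem integrable_acc (ξ : Trait) (j : ℕ) (f : Bool → ℝ) :
    Integrable (fun x => f (x j).1) (m.dataLaw ξ) := by
  obtain ⟨C, hC⟩ := (Set.finite_range fun r => ‖f r‖).bddAbove
  refine Integrable.of_bound (C := C) ?_ (ae_of_all _ fun x => hC ⟨_, rfl⟩)
  exact ((measurable_of_finite f).comp (measurable_acc j)).aestronglyMeasurable

theorem integral_accScore (ξ : Trait) (j : ℕ) :
    ∫ x, m.accScore j (x j).1 (ξ 0) ∂(m.dataLaw ξ) = 0 := by
  rw [m.integral_acc ξ j fun r => m.accScore j r (ξ 0)]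
  have h := mean_score (m.a j * ξ 0 + m.b j)
  simp only [accScore, arg, sgn, if_true, Bool.false_eq_true, if_false, one_mul, neg_mul]
  linear_combination m.a j * h

theorem integral_accCurv (ξ : Trait) (j : ℕ) :
    ∫ x, m.accCurv j (x j).1 (ξ 0) ∂(m.dataLaw ξ) = m.accInfo j (ξ 0) := by
  rw [m.integral_acc ξ j fun r => m.accCurv j r (ξ 0), accInfo_eq]
  have h := mean_curv (m.a j * ξ 0 + m.b j)
  simp only [accCurv, arg, sgn, if_true, Bool.false_eq_true, if_false, one_mul, neg_mul]
  linear_combination m.a j ^ 2 * h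

/-- The Hessian of the log posterior. -/
theorem hessian_logPost (hρ : |m.rho| < 1) {J : ℕ} {x : Data} (hx : Admissible J x) (ξ : Trait) :
    hessian (m.logPost J x) ξ =
      !![-(∑ j ∈ Finset.range J, m.accCurv j (x j).1 (ξ 0)) - 1 / (1 - m.rho ^ 2),
        m.rho / (1 - m.rho ^ 2); m.rho / (1 - m.rho ^ 2),
        -(∑ j ∈ Finset.range J, m.cotInfo j) - 1 / (1 - m.rho ^ 2)] := by
  have e : ∀ k : Fin 2, (fun η => lineDeriv ℝ (m.logPost J x) η (Pi.single k 1))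
      = fun η => m.postScore J x η k := fun k =>
    funext fun η => (m.hasLineDerivAt_logPost hρ hx η k).lineDeriv
  have hid : ∀ c d : ℝ, HasDerivAt (fun t : ℝ => c + t * d) d 0 := fun c d => by
    simpa using ((hasDerivAt_id (0 : ℝ)).mul_const d).const_add c
  have hacc : ∀ d : ℝ, HasDerivAt
      (fun t : ℝ => ∑ j ∈ Finset.range J, m.accScore j (x j).1 (ξ 0 + t * d))
      (-(∑ j ∈ Finset.range J, m.accCurv j (x j).1 (ξ 0)) * d) 0 := fun d => by
    rw [← Finset.sum_neg_distrib, Finset.sum_mul]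
    refine HasDerivAt.fun_sum fun j _ => ?_
    have h1 : HasDerivAt (fun t : ℝ => m.arg j (x j).1 (ξ 0 + t * d))
        (sgn (x j).1 * (m.a j * d)) 0 :=
      (((hid (ξ 0) d).const_mul (m.a j)).add_const (m.b j)).const_mul (sgn (x j).1)
    have h2 : HasDerivAt score (-curv (m.arg j (x j).1 (ξ 0)))
        (m.arg j (x j).1 (ξ 0 + 0 * d)) := by
      rw [zero_mul, add_zero]; exact hasDerivAt_score _
    have h3 := (h2.comp (0 : ℝ) h1).const_mul (sgn (x j).1 * m.a j)
    have e : -m.accCurv j (x j).1 (ξ 0) * d = sgn (x j).1 * m.a j *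
        (-curv (m.arg j (x j).1 (ξ 0)) * (sgn (x j).1 * (m.a j * d))) := by
      simp only [accCurv]
      linear_combination (m.a j ^ 2 * curv (m.arg j (x j).1 (ξ 0)) * d) * sgn_sq (x j).1
    rw [e]
    exact h3
  have hcot : ∀ d : ℝ, HasDerivAt
      (fun t : ℝ => ∑ j ∈ Finset.range J, m.cotScore j (x j).2 (ξ 1 + t * d))
      (-(∑ j ∈ Finset.range J, m.cotInfo j) * d) 0 := fun d => by
    rw [← Finset.sum_neg_distrib, Finset.sum_mul]
    refine HasDerivAt.fun_sum fun j _ => ?_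
    have h3 := (((hid (ξ 1) d).const_mul (m.vphi j)).const_add
      (Real.log (x j).2 - m.omega j)).const_mul (-(m.vphi j / m.lam j))
    have e : -m.cotInfo j * d = -(m.vphi j / m.lam j) * (m.vphi j * d) := by
      simp only [cotInfo]
      ring
    rw [e]
    exact h3
  have hp0 : ∀ d : Trait, HasDerivAt (fun t : ℝ => m.priorGrad (ξ + t • d) 0)
      ((d 0 - m.rho * d 1) / (1 - m.rho ^ 2)) 0 := fun d =>
    (((hid (ξ 0) (d 0)).fun_sub ((hid (ξ 1) (d 1)).const_mul m.rho)).div_const _)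
  have hp1 : ∀ d : Trait, HasDerivAt (fun t : ℝ => m.priorGrad (ξ + t • d) 1)
      ((d 1 - m.rho * d 0) / (1 - m.rho ^ 2)) 0 := fun d =>
    (((hid (ξ 1) (d 1)).fun_sub ((hid (ξ 0) (d 0)).const_mul m.rho)).div_const _)
  have h0 : ∀ d : Trait, lineDeriv ℝ (fun η => m.postScore J x η 0) ξ d
      = -(∑ j ∈ Finset.range J, m.accCurv j (x j).1 (ξ 0)) * d 0
        - (d 0 - m.rho * d 1) / (1 - m.rho ^ 2) := fun d =>
    HasLineDerivAt.lineDeriv ((hacc (d 0)).fun_sub (hp0 d))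
  have h1 : ∀ d : Trait, lineDeriv ℝ (fun η => m.postScore J x η 1) ξ d
      = -(∑ j ∈ Finset.range J, m.cotInfo j) * d 1
        - (d 1 - m.rho * d 0) / (1 - m.rho ^ 2) := fun d =>
    HasLineDerivAt.lineDeriv ((hcot (d 1)).fun_sub (hp1 d))
  ext i k
  simp only [hessian, Matrix.of_apply, e]
  fin_cases i <;> fin_cases k <;> simp [h0, h1] <;> ring

theorem postInfo_eq (hρ : |m.rho| < 1) (J : ℕ) (ξ : Trait) :
    m.postInfo J ξ =
      !![1 / (1 - m.rho ^ 2) + ∑ j ∈ Finset.range J, m.accInfo j (ξ 0),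
        -(m.rho / (1 - m.rho ^ 2)); -(m.rho / (1 - m.rho ^ 2)),
        1 / (1 - m.rho ^ 2) + ∑ j ∈ Finset.range J, m.cotInfo j] := by
  have hI : ∀ i k, m.postInfo J ξ i k = -∫ x,
      (!![-(∑ j ∈ Finset.range J, m.accCurv j (x j).1 (ξ 0)) - 1 / (1 - m.rho ^ 2),
        m.rho / (1 - m.rho ^ 2); m.rho / (1 - m.rho ^ 2),
        -(∑ j ∈ Finset.range J, m.cotInfo j) - 1 / (1 - m.rho ^ 2)] : Matrix (Fin 2) (Fin 2) ℝ) i k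
        ∂(m.dataLaw ξ) := fun i k => by
    rw [postInfo, Matrix.of_apply]
    congr 1
    refine integral_congr_ae ?_
    filter_upwards [m.ae_admissible ξ J] with x hx
    rw [m.hessian_logPost hρ hx]
  have hi : ∀ j ∈ Finset.range J, Integrable (fun x : Data => m.accCurv j (x j).1 (ξ 0))
      (m.dataLaw ξ) := fun j _ => m.integrable_acc ξ j fun r => m.accCurv j r (ξ 0)
  ext i k
  rw [hI]
  fin_cases i <;> fin_cases k
  · simp only [Fin.zero_eta, Matrix.of_apply, Matrix.cons_val', Matrix.cons_val_zero]
    rw [integral_sub (integrable_finsetSum _ hi).fun_neg (integrable_const _), integral_neg,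
      integral_finsetSum _ hi]
    simp only [integral_accCurv, integral_const, probReal_univ, one_smul]
    ring
  all_goals simp

end Params

/-! ### Laplace approximation in standardized coordinates -/

/-- The unnormalized standard bivariate normal density. -/
def gauss₂ (u : Trait) : ℝ := Real.exp (-(u 0 ^ 2 + u 1 ^ 2) / 2)

theorem stdNormal₂_eq : stdNormal₂ =
    (volume : Measure Trait).withDensity fun u => ENNReal.ofReal (∏ i, phi (u i)) := by
  have hi : Integrable (fun u : Trait => ∏ i, phi (u i)) :=
    Integrable.fintype_prod fun _ => integrable_phi
  refine Measure.pi_eq fun s hs => ?_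
  rw [withDensity_apply _ (MeasurableSet.univ_pi hs), ← ofReal_integral_eq_lintegral_ofReal
    hi.integrableOn (ae_of_all _ fun u => Finset.prod_nonneg fun i _ => (phi_pos _).le),
    volume_pi, Measure.restrict_pi_pi, integral_fintype_prod_eq_prod (fun _ => phi),
    ENNReal.ofReal_prod_of_nonneg fun i _ => integral_nonneg fun t => (phi_pos t).le]
  refine Finset.prod_congr rfl fun i _ => ?_
  rw [gaussianReal_apply_eq_integral _ one_ne_zero]
  rfl

theorem prod_phi (u : Trait) : ∏ i, phi (u i) = phi 0 ^ 2 * gauss₂ u := by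
  simp only [Fin.prod_univ_two, phi_eq, gauss₂]
  rw [show -(u 0 ^ 2 + u 1 ^ 2) / 2 = -(u 0 ^ 2) / 2 + -(u 1 ^ 2) / 2 by ring, Real.exp_add]
  simp
  ring

theorem continuous_gauss₂ : Continuous gauss₂ := by unfold gauss₂; fun_prop

theorem withDensity_real {g : Trait → ℝ} (hg : Measurable g) (h0 : ∀ u, 0 ≤ g u) {A : Set Trait}
    (hA : MeasurableSet A) :
    (volume.withDensity fun u => ENNReal.ofReal (g u)).real A = ∫ u in A, g u := by
  rw [integral_eq_lintegral_of_nonneg_ae (ae_of_all _ h0) hg.aestronglyMeasurable, Measure.real,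
    withDensity_apply _ hA]

theorem stdNormal₂_real {B : Set Trait} (hB : MeasurableSet B) :
    stdNormal₂.real B = (∫ u in B, gauss₂ u) / ∫ u, gauss₂ u := by
  have hp : IsProbabilityMeasure stdNormal₂ := by unfold stdNormal₂; infer_instance
  have h : ∀ A, MeasurableSet A → stdNormal₂.real A = phi 0 ^ 2 * ∫ u in A, gauss₂ u :=
    fun A hA => by
      rw [stdNormal₂_eq]
      simp only [prod_phi]
      rw [withDensity_real (continuous_gauss₂.measurable.const_mul _)
        (fun u => mul_nonneg (sq_nonneg _) (Real.exp_pos _).le) hA, integral_const_mul]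
  have h1 := h Set.univ MeasurableSet.univ
  rw [probReal_univ, setIntegral_univ] at h1
  have h2 : (∫ u, gauss₂ u) ≠ 0 := fun h0 => by simp [h0] at h1
  rw [h B hB, eq_div_iff h2]
  linear_combination (-∫ u in B, gauss₂ u) * h1

theorem integrable_exp_neg_mul_abs {c : ℝ} (hc : 0 < c) :
    Integrable fun t : ℝ => Real.exp (-c * |t|) := by
  rw [← integrableOn_univ, ← Set.Iic_union_Ioi (a := (0 : ℝ)), integrableOn_union]
  constructor
  · refine (integrableOn_exp_mul_Iic hc 0).congr_fun (fun t ht => ?_) measurableSet_Iic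
    simp only [abs_of_nonpos (Set.mem_Iic.1 ht)]
    congr 1; ring
  · refine (integrableOn_exp_mul_Ioi (neg_lt_zero.2 hc) 0).congr_fun (fun t ht => ?_)
      measurableSet_Ioi
    simp only [abs_of_pos (Set.mem_Ioi.1 ht)]

theorem integrable_exp_sub_mul_abs {c : ℝ} (hc : 0 < c) (C : ℝ) :
    Integrable fun u : Trait => Real.exp (C - c * (|u 0| + |u 1|)) := by
  have h : Integrable fun u : Trait => ∏ i, Real.exp (-c * |u i|) :=
    Integrable.fintype_prod fun _ => integrable_exp_neg_mul_abs hc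
  refine (h.const_mul (Real.exp C)).congr (ae_of_all _ fun u => ?_)
  simp only [Fin.prod_univ_two, ← Real.exp_add]
  congr 1; ring

/-- Standardized log densities that converge pointwise to the Gaussian one and have uniform
exponential tails yield Gaussian limits of probabilities. -/
theorem tendsto_ratio_gauss {ι : Type*} {l : Filter ι} [l.IsCountablyGenerated]
    {Q : ι → Trait → ℝ} {c C : ℝ} (hc : 0 < c) (hm : ∀ᶠ k in l, Continuous (Q k))
    (hb : ∀ᶠ k in l, ∀ u, Q k u ≤ C - c * (|u 0| + |u 1|))
    (ht : ∀ u, Tendsto (fun k => Q k u) l (𝓝 (-(u 0 ^ 2 + u 1 ^ 2) / 2)))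
    {B : Set Trait} (hB : MeasurableSet B) :
    Tendsto (fun k => (∫ u in B, Real.exp (Q k u)) / ∫ u, Real.exp (Q k u)) l
      (𝓝 (stdNormal₂.real B)) := by
  have key : ∀ A : Set Trait, Tendsto (fun k => ∫ u in A, Real.exp (Q k u)) l
      (𝓝 (∫ u in A, gauss₂ u)) := fun A => by
    refine tendsto_integral_filter_of_dominated_convergence
      (fun u => Real.exp (C - c * (|u 0| + |u 1|))) ?_ ?_
      (integrable_exp_sub_mul_abs hc C).integrableOn ?_
    · filter_upwards [hm] with k hk using
        (Real.continuous_exp.comp hk).aestronglyMeasurable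
    · filter_upwards [hb] with k hk
      refine ae_of_all _ fun u => ?_
      rw [Real.norm_eq_abs, Real.abs_exp]
      exact Real.exp_le_exp.2 (hk u)
    · exact ae_of_all _ fun u => (Real.continuous_exp.tendsto _).comp (ht u)
  have h2 : (∫ u, gauss₂ u) ≠ 0 := by
    have hg : Integrable gauss₂ := by
      refine Integrable.mono' (integrable_exp_sub_mul_abs (c := 1) one_pos 1)
        continuous_gauss₂.aestronglyMeasurable (ae_of_all _ fun u => ?_)
      rw [gauss₂, Real.norm_eq_abs, Real.abs_exp]
      refine Real.exp_le_exp.2 ?_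
      rw [← sq_abs (u 0), ← sq_abs (u 1)]
      nlinarith [sq_nonneg (|u 0| - 1), sq_nonneg (|u 1| - 1)]
    exact (integral_exp_pos hg).ne'
  rw [stdNormal₂_real hB]
  have h1 := key Set.univ
  simp only [setIntegral_univ] at h1
  exact (key B).div h1 h2

theorem setIntegral_standardize (S : Matrix (Fin 2) (Fin 2) ℝ) (hS : S.det ≠ 0) (w : Trait)
    {f : Trait → ℝ} (hf : Continuous f) {B : Set Trait} (hB : MeasurableSet B) :
    ∫ ξ in {ξ | S.mulVec (ξ - w) ∈ B}, f (ξ - w)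
      = |S.det⁻¹| * ∫ u in B, f (S⁻¹.mulVec u) := by
  have hc : Continuous fun v : Trait => S.mulVec v := by fun_prop
  have hSm : MeasurableSet {v : Trait | S.mulVec v ∈ B} := hc.measurable hB
  have h1 : MeasurableSet {ξ : Trait | S.mulVec (ξ - w) ∈ B} :=
    (hc.comp (continuous_sub_right w)).measurable hB
  have h2 := integral_sub_right_eq_self (μ := (volume : Measure Trait))
    ({v : Trait | S.mulVec v ∈ B}.indicator f) w
  have h3 : ∫ ξ in {ξ | S.mulVec (ξ - w) ∈ B}, f (ξ - w)
      = ∫ v in {v : Trait | S.mulVec v ∈ B}, f v := by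
    rw [← integral_indicator h1, ← integral_indicator hSm, ← h2]
    rfl
  have h4 := setIntegral_map (μ := (volume : Measure Trait)) (g := Matrix.toLin' S)
    (f := fun u => f (S⁻¹.mulVec u)) hB
    (hf.comp (by fun_prop : Continuous fun u : Trait => S⁻¹.mulVec u)).aestronglyMeasurable
    hc.measurable.aemeasurable
  rw [Real.map_matrix_volume_pi_eq_smul_volume_pi hS, Measure.restrict_smul, integral_smul_measure,
    ENNReal.toReal_ofReal (abs_nonneg _), smul_eq_mul] at h4
  rw [h3, h4]
  refine setIntegral_congr_fun hSm fun v _ => ?_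
  rw [Matrix.toLin'_apply, Matrix.mulVec_mulVec,
    Matrix.nonsing_inv_mul _ (isUnit_iff_ne_zero.2 hS), Matrix.one_mulVec]

namespace Params

variable (m : Params)

theorem prior_pos (hρ : |m.rho| < 1) (ξ : Trait) : 0 < m.prior ξ := by
  have h : 0 < m.Sigma.det := by
    have := m.one_sub_rho_sq_pos hρ
    simp only [Sigma, Matrix.det_fin_two_of]
    nlinarith
  have := Real.sqrt_pos.2 h
  have := Real.pi_pos
  unfold prior
  positivity

/-- Bayes' formula in standardized coordinates. -/
theorem postProb_eq (hρ : |m.rho| < 1) {J : ℕ} {x : Data} (hx : Admissible J x)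
    (hS : (m.sqrtPostInfo J (m.mode J x)).det ≠ 0) {B : Set Trait} (hB : MeasurableSet B)
    {Q : Trait → ℝ} (hQ : ∀ u, Q u = m.logPost J x (m.mode J x +
      (m.sqrtPostInfo J (m.mode J x))⁻¹.mulVec u) - m.logPost J x (m.mode J x)) :
    m.postProb B J x = (∫ u in B, Real.exp (Q u)) / ∫ u, Real.exp (Q u) := by
  set w := m.mode J x
  set S := m.sqrtPostInfo J w
  set D := m.prior 0 * Real.exp (m.logPost J x w)
  have hD : D ≠ 0 := (mul_pos (m.prior_pos hρ 0) (Real.exp_pos _)).ne'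
  set f : Trait → ℝ := fun v => Real.exp (m.logPost J x (w + v) - m.logPost J x w)
  have hlp := m.continuous_logPost hρ hx
  have hf : Continuous f := by
    refine Real.continuous_exp.comp ((hlp.comp (continuous_const_add w)).sub continuous_const)
  have hdens : ∀ ξ, m.prior ξ * m.lik J x ξ = D * f (ξ - w) := fun ξ => by
    have h0 : m.quad 0 = 0 := by simp [quad]
    simp only [D, f, prior, m.lik_eq_exp hx, add_sub_cancel, h0, mul_zero, Real.exp_zero, mul_one]
    rw [mul_assoc, mul_assoc _ (Real.exp _) (Real.exp _), ← Real.exp_add, ← Real.exp_add]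
    congr 2
    simp only [logPost]
    ring
  have hj : ∀ A, MeasurableSet A → (m.jointMeasure J x).real A
      = D * ∫ ξ in A, f (ξ - w) := fun A hA => by
    rw [jointMeasure]
    simp only [hdens]
    have hfm : Measurable fun ξ => D * f (ξ - w) :=
      (hf.comp (continuous_sub_right w)).measurable.const_mul D
    rw [withDensity_real hfm
      (fun u => mul_nonneg (mul_nonneg (m.prior_pos hρ 0).le (Real.exp_pos _).le)
        (Real.exp_pos _).le) hA, integral_const_mul]
  have hint : ∀ A, MeasurableSet A → (m.jointMeasure J x).real {ξ | S.mulVec (ξ - w) ∈ A}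
      = D * (|S.det⁻¹| * ∫ u in A, Real.exp (Q u)) := fun A hA => by
    have hc : Continuous fun ξ : Trait => S.mulVec (ξ - w) := by fun_prop
    have hA' : MeasurableSet {ξ : Trait | S.mulVec (ξ - w) ∈ A} := hc.measurable hA
    rw [hj _ hA', setIntegral_standardize S hS w hf hA]
    simp only [f, hQ]
  have hu := hint Set.univ MeasurableSet.univ
  simp only [Set.mem_univ, Set.ofPred_true, setIntegral_univ] at hu
  have hdet : |S.det⁻¹| ≠ 0 := by simpa using hS
  have e : m.postProb B J x = ((m.jointMeasure J x).real Set.univ)⁻¹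
      * (m.jointMeasure J x).real {ξ | S.mulVec (ξ - w) ∈ B} := by
    simp [postProb, posterior, Measure.real, S, w]
  rw [e, hu, hint B hB, inv_mul_eq_div, mul_div_mul_left _ _ hD, mul_div_mul_left _ _ hdet]

/-! ### Uniform bounds for regular sequences of items -/

/-- Item parameters are bounded by `A`, and information accumulates at least at the linear
rate `κ`. -/
structure Regular (A κ : ℝ) (J₁ : ℕ) : Prop where
  rho : |m.rho| < 1
  one_le : 1 ≤ A
  a_le : ∀ j, |m.a j| ≤ A
  b_le : ∀ j, |m.b j| ≤ A
  cot_le : ∀ j, m.cotInfo j ≤ A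
  pos : 0 < κ
  acc_growth : ∀ J ≥ J₁, κ * J ≤ ∑ j ∈ Finset.range J, m.a j ^ 2
  cot_growth : ∀ J ≥ J₁, κ * J ≤ ∑ j ∈ Finset.range J, m.cotInfo j

/-- The size allowed for the fluctuations of sums over `J` items. -/
def rate (J : ℕ) : ℝ := (J : ℝ) ^ (3 / 4 : ℝ)

theorem tendsto_rate_div : Tendsto (fun J : ℕ => rate J / J) atTop (𝓝 0) := by
  have h := (tendsto_rpow_neg_atTop (y := 1 / 4) (by norm_num)).comp tendsto_natCast_atTop_atTop
  refine h.congr' ?_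
  filter_upwards [eventually_gt_atTop 0] with J hJ
  have hJ' : (0 : ℝ) < J := by exact_mod_cast hJ
  rw [Function.comp_apply, rate, eq_div_iff hJ'.ne']
  nth_rw 2 [← Real.rpow_one (J : ℝ)]
  rw [← Real.rpow_add hJ']
  norm_num

/-- Data whose score and curvature at `ξ` deviate little from their means. -/
structure Typical (J : ℕ) (ξ : Trait) (x : Data) : Prop where
  admissible : Admissible J x
  acc : |∑ j ∈ Finset.range J, m.accScore j (x j).1 (ξ 0)| ≤ rate J
  cot : |∑ j ∈ Finset.range J, m.cotScore j (x j).2 (ξ 1)| ≤ rate J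
  curv : |∑ j ∈ Finset.range J, (m.accInfo j (ξ 0) - m.accCurv j (x j).1 (ξ 0))| ≤ rate J

variable {m}
variable {A κ : ℝ} {J₁ : ℕ}

theorem abs_sum_range_le {f : ℕ → ℝ} {K : ℝ} (h : ∀ j, |f j| ≤ K) (J : ℕ) :
    |∑ j ∈ Finset.range J, f j| ≤ K * J := by
  refine (Finset.abs_sum_le_sum_abs _ _).trans ((Finset.sum_le_sum fun j _ => h j).trans ?_)
  simp [mul_comm]

namespace Regular

theorem A_nonneg (h : m.Regular A κ J₁) : 0 ≤ A := zero_le_one.trans h.one_le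

theorem a_sq_le (h : m.Regular A κ J₁) (j : ℕ) : m.a j ^ 2 ≤ A ^ 2 :=
  sq_le_sq' (abs_le.1 (h.a_le j)).1 (abs_le.1 (h.a_le j)).2

theorem abs_lin_le (h : m.Regular A κ J₁) {N : ℝ} (j : ℕ) {θ : ℝ} (hθ : |θ| ≤ N) :
    |m.a j * θ + m.b j| ≤ A * N + A := by
  refine (abs_add_le _ _).trans (add_le_add ?_ (h.b_le j))
  rw [abs_mul]
  exact mul_le_mul (h.a_le j) hθ (abs_nonneg _) h.A_nonneg

theorem abs_arg_le (h : m.Regular A κ J₁) {N : ℝ} (j : ℕ) (r : Bool) {θ : ℝ} (hθ : |θ| ≤ N) :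
    |m.arg j r θ| ≤ A * N + A := by
  rw [m.abs_arg]; exact h.abs_lin_le j hθ

theorem accRem_le (h : m.Regular A κ J₁) (N : ℝ) :
    ∃ c, 0 < c ∧ ∀ j r θ y, |θ| ≤ N → m.accRem j r θ y ≤ -(c * m.a j ^ 2 * hub y) := by
  obtain ⟨c, hc, hle⟩ := exists_logPhiRem_le (A * N + A)
  have hA : 0 < A := zero_lt_one.trans_le h.one_le
  refine ⟨c / A, by positivity, fun j r θ y hθ => ?_⟩
  refine (hle _ _ (h.abs_arg_le j r hθ)).trans ?_
  have h1 : m.a j ^ 2 * hub y / A ≤ hub (sgn r * m.a j * y) := by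
    rw [div_le_iff₀ hA]
    have hy1 : hub y ≤ y ^ 2 := min_le_left _ _
    have hy2 : hub y ≤ |y| := min_le_right _ _
    have ha := h.a_le j
    rw [hub.eq_def (sgn r * m.a j * y), min_mul_of_nonneg _ _ hA.le]
    refine le_min ?_ ?_
    · have e : (sgn r * m.a j * y) ^ 2 = m.a j ^ 2 * y ^ 2 := by
        rw [mul_pow, mul_pow, sgn_sq, one_mul]
      rw [e]
      have : m.a j ^ 2 * y ^ 2 * 1 ≤ m.a j ^ 2 * y ^ 2 * A :=
        mul_le_mul_of_nonneg_left h.one_le (by positivity)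
      have := mul_le_mul_of_nonneg_left hy1 (sq_nonneg (m.a j))
      linarith
    · rw [abs_mul, abs_mul, abs_sgn, one_mul, ← sq_abs (m.a j)]
      calc |m.a j| ^ 2 * hub y ≤ |m.a j| ^ 2 * |y| := by gcongr
        _ = |m.a j| * |y| * |m.a j| := by ring
        _ ≤ |m.a j| * |y| * A := by gcongr
  have h2 := mul_le_mul_of_nonneg_left h1 hc.le
  have e : c / A * m.a j ^ 2 * hub y = c * (m.a j ^ 2 * hub y / A) := by ring
  rw [e]
  linarith

theorem sum_accRem_le (h : m.Regular A κ J₁) (N : ℝ) :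
    ∃ c, 0 < c ∧ ∀ J ≥ J₁, ∀ (x : Data) θ y, |θ| ≤ N →
      ∑ j ∈ Finset.range J, m.accRem j (x j).1 θ y ≤ -(c * J * hub y) := by
  obtain ⟨c, hc, hle⟩ := h.accRem_le N
  refine ⟨c * κ, mul_pos hc h.pos, fun J hJ x θ y hθ => ?_⟩
  refine (Finset.sum_le_sum fun j _ => hle j (x j).1 θ y hθ).trans ?_
  rw [Finset.sum_neg_distrib, neg_le_neg_iff, ← Finset.sum_mul, ← Finset.mul_sum]
  refine mul_le_mul_of_nonneg_right ?_ (hub_nonneg y)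
  have := mul_le_mul_of_nonneg_left (h.acc_growth J hJ) hc.le
  linarith

theorem abs_accRem_add_le (h : m.Regular A κ J₁) (N : ℝ) :
    ∃ K, 0 < K ∧ ∀ j r θ y, |θ| ≤ N → |y| ≤ 1 →
      |m.accRem j r θ y + m.accCurv j r θ * y ^ 2 / 2| ≤ K * |y| ^ 3 := by
  obtain ⟨K, hK, hle⟩ := exists_abs_logPhiRem_add_le (max (A * N + A) A)
  have hA := h.A_nonneg
  have hA' : 0 < A := zero_lt_one.trans_le h.one_le
  refine ⟨K * A ^ 3, by positivity, fun j r θ y hθ hy => ?_⟩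
  have hay : |sgn r * m.a j * y| ≤ A * |y| := by
    rw [abs_mul, abs_mul, abs_sgn, one_mul]
    exact mul_le_mul_of_nonneg_right (h.a_le j) (abs_nonneg y)
  have h1 := hle (m.arg j r θ) (sgn r * m.a j * y) ((h.abs_arg_le j r hθ).trans (le_max_left _ _))
    (hay.trans ((mul_le_of_le_one_right hA hy).trans (le_max_right _ _)))
  have e : curv (m.arg j r θ) * (sgn r * m.a j * y) ^ 2 / 2 = m.accCurv j r θ * y ^ 2 / 2 := by
    rw [mul_pow, mul_pow, sgn_sq, accCurv]; ring
  rw [e] at h1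
  refine h1.trans ?_
  calc K * |sgn r * m.a j * y| ^ 3 ≤ K * (A * |y|) ^ 3 := by gcongr
    _ = K * A ^ 3 * |y| ^ 3 := by ring

theorem lipschitz_curv (h : m.Regular A κ J₁) (N : ℝ) :
    ∃ K, 0 < K ∧ ∀ j r θ θ', |θ| ≤ N → |θ'| ≤ N →
      |(m.accInfo j θ - m.accCurv j r θ) - (m.accInfo j θ' - m.accCurv j r θ')|
        ≤ K * |θ - θ'| := by
  obtain ⟨K₁, hK₁, h1⟩ := exists_lipschitz_of_contDiff contDiff_binInfo (A * N + A)
  obtain ⟨K₂, hK₂, h2⟩ := exists_lipschitz_of_contDiff contDiff_curv (A * N + A)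
  have hA := h.A_nonneg
  have hA' : 0 < A := zero_lt_one.trans_le h.one_le
  refine ⟨A ^ 2 * (K₁ + K₂) * A, by positivity, fun j r θ θ' hθ hθ' => ?_⟩
  have e1 : |binInfo (m.a j * θ + m.b j) - binInfo (m.a j * θ' + m.b j)|
      ≤ K₁ * (A * |θ - θ'|) := by
    refine (h1 _ _ (h.abs_lin_le j hθ) (h.abs_lin_le j hθ')).trans ?_
    rw [add_sub_add_right_eq_sub, ← mul_sub, abs_mul]
    gcongr
    exact h.a_le j
  have e2 : |curv (m.arg j r θ) - curv (m.arg j r θ')| ≤ K₂ * (A * |θ - θ'|) := by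
    refine (h2 _ _ (h.abs_arg_le j r hθ) (h.abs_arg_le j r hθ')).trans ?_
    rw [arg, arg, ← mul_sub, add_sub_add_right_eq_sub, ← mul_sub, abs_mul, abs_mul, abs_sgn,
      one_mul]
    gcongr
    exact h.a_le j
  have e3 : (m.accInfo j θ - m.accCurv j r θ) - (m.accInfo j θ' - m.accCurv j r θ')
      = m.a j ^ 2 * ((binInfo (m.a j * θ + m.b j) - binInfo (m.a j * θ' + m.b j))
        - (curv (m.arg j r θ) - curv (m.arg j r θ'))) := by
    simp only [accInfo_eq, accCurv]; ring
  rw [e3, abs_mul, abs_of_nonneg (sq_nonneg (m.a j))]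
  calc m.a j ^ 2 * |(binInfo (m.a j * θ + m.b j) - binInfo (m.a j * θ' + m.b j))
        - (curv (m.arg j r θ) - curv (m.arg j r θ'))|
      ≤ A ^ 2 * (K₁ * (A * |θ - θ'|) + K₂ * (A * |θ - θ'|)) :=
        mul_le_mul (h.a_sq_le j) ((abs_sub _ _).trans (add_le_add e1 e2)) (abs_nonneg _)
          (by positivity)
    _ = A ^ 2 * (K₁ + K₂) * A * |θ - θ'| := by ring

theorem accInfo_bounds (h : m.Regular A κ J₁) (N : ℝ) :
    ∃ c K, 0 < c ∧ 0 < K ∧ ∀ j θ, |θ| ≤ N →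
      c * m.a j ^ 2 ≤ m.accInfo j θ ∧ m.accInfo j θ ≤ K := by
  obtain ⟨c, hc, h1⟩ := exists_pos_le_of_continuous contDiff_binInfo.continuous binInfo_pos
    (A * N + A)
  obtain ⟨K, hK, h2⟩ := exists_abs_le_of_continuous contDiff_binInfo.continuous (A * N + A)
  have hA' : 0 < A := zero_lt_one.trans_le h.one_le
  refine ⟨c, A ^ 2 * K, hc, by positivity, fun j θ hθ => ?_⟩
  rw [accInfo_eq, mul_comm c]
  exact ⟨mul_le_mul_of_nonneg_left (h1 _ (h.abs_lin_le j hθ)) (sq_nonneg _),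
    mul_le_mul (h.a_sq_le j) ((le_abs_self _).trans (h2 _ (h.abs_lin_le j hθ)))
      (binInfo_pos _).le (by positivity)⟩

theorem abs_accScore_le (h : m.Regular A κ J₁) (N : ℝ) :
    ∃ K, 0 < K ∧ ∀ j r θ, |θ| ≤ N → |m.accScore j r θ| ≤ K := by
  obtain ⟨K, hK, h1⟩ := exists_abs_le_of_continuous contDiff_score.continuous (A * N + A)
  have hA' : 0 < A := zero_lt_one.trans_le h.one_le
  refine ⟨A * K, by positivity, fun j r θ hθ => ?_⟩
  rw [accScore, abs_mul, abs_mul, abs_sgn, one_mul]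
  exact mul_le_mul (h.a_le j) (h1 _ (h.abs_arg_le j r hθ)) (abs_nonneg _) h.A_nonneg

theorem abs_accInfo_sub_le (h : m.Regular A κ J₁) (N : ℝ) :
    ∃ K, 0 < K ∧ ∀ j r θ, |θ| ≤ N → |m.accInfo j θ - m.accCurv j r θ| ≤ K := by
  obtain ⟨K₁, hK₁, h1⟩ := exists_abs_le_of_continuous contDiff_binInfo.continuous (A * N + A)
  obtain ⟨K₂, hK₂, h2⟩ := exists_abs_le_of_continuous contDiff_curv.continuous (A * N + A)
  have hA' : 0 < A := zero_lt_one.trans_le h.one_le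
  refine ⟨A ^ 2 * (K₁ + K₂), by positivity, fun j r θ hθ => ?_⟩
  rw [accInfo_eq, accCurv, ← mul_sub, abs_mul, abs_of_nonneg (sq_nonneg (m.a j))]
  exact mul_le_mul (h.a_sq_le j) ((abs_sub _ _).trans (add_le_add (h1 _ (h.abs_lin_le j hθ))
    (h2 _ (h.abs_arg_le j r hθ)))) (abs_nonneg _) (by positivity)

theorem abs_le_of_hub_add_hub_le {η s t : ℝ} (h0 : 0 ≤ η) (h1 : η < 1)
    (h : hub s + hub t ≤ η / 2 * (|s| + |t|)) : |s| ≤ η ∧ |t| ≤ η := by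
  have key : ∀ M : ℝ, 0 ≤ M → hub M ≤ η * M → M ≤ η := fun M hM hle => by
    rcases hM.eq_or_lt with hM0 | hM0
    · exact hM0 ▸ h0
    rw [hub, abs_of_pos hM0] at hle
    rcases min_le_iff.1 hle with h2 | h2
    · rw [sq] at h2
      exact le_of_mul_le_mul_right h2 hM0
    · nlinarith
  have hub_abs : ∀ y, hub |y| = hub y := fun y => by simp [hub]
  have e0 := hub_nonneg s
  have e1 := hub_nonneg t
  rcases le_total |s| |t| with hv | hv
  · have : |t| ≤ η := key _ (abs_nonneg _) (by rw [hub_abs]; nlinarith)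
    exact ⟨hv.trans this, this⟩
  · have : |s| ≤ η := key _ (abs_nonneg _) (by rw [hub_abs]; nlinarith)
    exact ⟨this, hv.trans this⟩

/-- Consistency of the posterior mode, uniformly over bounded traits and typical data. -/
theorem mode_close (h : m.Regular A κ J₁) (N : ℝ) :
    ∃ η : ℕ → ℝ, Tendsto η atTop (𝓝 0) ∧ ∀ᶠ J in atTop, ∀ ξ x, |ξ 0| ≤ N → |ξ 1| ≤ N →
      m.Typical J ξ x → |m.mode J x 0 - ξ 0| ≤ η J ∧ |m.mode J x 1 - ξ 1| ≤ η J := by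
  obtain ⟨c₀, hc₀, hrem⟩ := h.sum_accRem_le N
  have hr := m.one_sub_rho_sq_pos h.rho
  set P := 2 * N / (1 - m.rho ^ 2)
  set c := min c₀ (κ / 2)
  have hκ := h.pos
  have hc : 0 < c := lt_min hc₀ (by positivity)
  set η : ℕ → ℝ := fun J => 2 * ((rate J / J + P / J) / c)
  have hη : Tendsto η atTop (𝓝 0) := by
    have := ((tendsto_rate_div.add (tendsto_const_div_atTop_nhds_zero_nat P)).div_const
      c).const_mul 2
    simpa using this
  refine ⟨η, hη, ?_⟩
  filter_upwards [eventually_ge_atTop J₁, eventually_gt_atTop 0, hη.eventually_lt_const one_pos]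
    with J hJ₁ hJ0 hη1 ξ x h0 h1 hx
  have hJ : (0 : ℝ) < J := by exact_mod_cast hJ0
  set w := m.mode J x
  set v : Trait := w - ξ
  have hmax := m.mode_isMax h.rho hx.admissible ξ
  have hexp := m.logPost_add h.rho hx.admissible ξ v
  rw [add_sub_cancel] at hexp
  have hP : ∀ s t : ℝ, |s| ≤ N → |t| ≤ N → |(s - m.rho * t) / (1 - m.rho ^ 2)| ≤ P :=
    fun s t hs ht => by
      rw [abs_div, abs_of_pos hr]
      refine div_le_div_of_nonneg_right ?_ hr.le
      have : |m.rho * t| ≤ 1 * N := by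
        rw [abs_mul]; exact mul_le_mul h.rho.le ht (abs_nonneg _) zero_le_one
      linarith [abs_sub s (m.rho * t)]
  have hs0 : |m.postScore J x ξ 0| ≤ rate J + P :=
    (abs_sub _ _).trans (add_le_add hx.acc (hP _ _ h0 h1))
  have hs1 : |m.postScore J x ξ 1| ≤ rate J + P :=
    (abs_sub _ _).trans (add_le_add hx.cot (hP _ _ h1 h0))
  have b0 : m.postScore J x ξ 0 * v 0 ≤ (rate J + P) * |v 0| := by
    refine (le_abs_self _).trans ?_
    rw [abs_mul]
    exact mul_le_mul_of_nonneg_right hs0 (abs_nonneg _)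
  have b1 : m.postScore J x ξ 1 * v 1 ≤ (rate J + P) * |v 1| := by
    refine (le_abs_self _).trans ?_
    rw [abs_mul]
    exact mul_le_mul_of_nonneg_right hs1 (abs_nonneg _)
  have b2 := hrem J hJ₁ x (ξ 0) (v 0) h0
  have b3 : κ * J * v 1 ^ 2 ≤ (∑ j ∈ Finset.range J, m.cotInfo j) * v 1 ^ 2 :=
    mul_le_mul_of_nonneg_right (h.cot_growth J hJ₁) (sq_nonneg _)
  have b4 := m.quad_nonneg h.rho v
  have b5 : hub (v 1) ≤ v 1 ^ 2 := min_le_left _ _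
  have c1 : c * J * hub (v 0) ≤ c₀ * J * hub (v 0) := by
    have := hub_nonneg (v 0)
    gcongr
    exact min_le_left _ _
  have c2 : c * J * hub (v 1) ≤ κ / 2 * J * v 1 ^ 2 := by
    have := hub_nonneg (v 1)
    have : c ≤ κ / 2 := min_le_right _ _
    gcongr
  have main : c * J * (hub (v 0) + hub (v 1)) ≤ (rate J + P) * (|v 0| + |v 1|) := by
    linarith
  have hηJ : rate J + P = c * J * (η J / 2) := by
    simp only [η]
    field_simp
  rw [hηJ, mul_assoc _ (η J / 2)] at main
  have main2 := le_of_mul_le_mul_left main (mul_pos hc hJ)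
  have hη0 : 0 ≤ η J := by
    have : 0 ≤ c * J * (η J / 2) := hηJ ▸ (abs_nonneg _).trans hs0
    have := nonneg_of_mul_nonneg_right this (mul_pos hc hJ)
    linarith
  exact abs_le_of_hub_add_hub_le hη0 hη1 main2

end Regular

/-! ### Local expansion at the posterior mode -/

theorem quadForm_postInfo (hρ : |m.rho| < 1) (J : ℕ) (ξ v : Trait) :
    dotProduct v ((m.postInfo J ξ).mulVec v)
      = (∑ j ∈ Finset.range J, m.accInfo j (ξ 0)) * v 0 ^ 2
        + (∑ j ∈ Finset.range J, m.cotInfo j) * v 1 ^ 2 + m.quad v := by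
  rw [m.postInfo_eq hρ, m.quad_eq hρ]
  simp [dotProduct, Matrix.mulVec, Fin.sum_univ_two]
  ring

theorem quad_le (hρ : |m.rho| < 1) (v : Trait) :
    m.quad v ≤ 2 / (1 - m.rho ^ 2) * (v 0 ^ 2 + v 1 ^ 2) := by
  have hr := m.one_sub_rho_sq_pos hρ
  rw [m.quad_eq hρ, div_mul_eq_mul_div]
  refine div_le_div_of_nonneg_right ?_ hr.le
  obtain ⟨h1, h2⟩ := abs_lt.1 hρ
  nlinarith [mul_nonneg (sub_nonneg.2 h2.le) (sq_nonneg (v 0 - v 1)),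
    mul_nonneg (by linarith : 0 ≤ 1 + m.rho) (sq_nonneg (v 0 + v 1))]

namespace Regular

theorem quadForm_bounds (h : m.Regular A κ J₁) (N : ℝ) :
    ∃ c K, 0 < c ∧ 1 ≤ K ∧ ∀ J ≥ J₁, 0 < J → ∀ ξ v : Trait, |ξ 0| ≤ N →
      c * J * (v 0 ^ 2 + v 1 ^ 2) ≤ dotProduct v ((m.postInfo J ξ).mulVec v) ∧
      dotProduct v ((m.postInfo J ξ).mulVec v) ≤ K * J * (v 0 ^ 2 + v 1 ^ 2) := by
  obtain ⟨c₀, K₀, hc₀, hK₀, hb⟩ := h.accInfo_bounds N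
  have hr := m.one_sub_rho_sq_pos h.rho
  have hκ := h.pos
  have hA := h.one_le
  refine ⟨min (c₀ * κ) κ, K₀ + A + 2 / (1 - m.rho ^ 2), by positivity, ?_, ?_⟩
  · have : 0 < 2 / (1 - m.rho ^ 2) := by positivity
    linarith
  intro J hJ₁ hJ0 ξ v hξ
  have hJ : (1 : ℝ) ≤ J := by exact_mod_cast hJ0
  rw [quadForm_postInfo h.rho]
  have hq0 := m.quad_nonneg h.rho v
  have hq1 := quad_le h.rho v
  have l0 : c₀ * κ * J ≤ ∑ j ∈ Finset.range J, m.accInfo j (ξ 0) := by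
    refine le_trans ?_ (Finset.sum_le_sum fun j _ => (hb j _ hξ).1)
    rw [← Finset.mul_sum, mul_assoc]
    exact mul_le_mul_of_nonneg_left (h.acc_growth J hJ₁) hc₀.le
  have u0 : ∑ j ∈ Finset.range J, m.accInfo j (ξ 0) ≤ K₀ * J := by
    refine (Finset.sum_le_sum fun j _ => (hb j _ hξ).2).trans ?_
    simp [mul_comm]
  have l1 := h.cot_growth J hJ₁
  have u1 : ∑ j ∈ Finset.range J, m.cotInfo j ≤ A * J := by
    refine (Finset.sum_le_sum fun j _ => h.cot_le j).trans ?_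
    simp [mul_comm]
  have s0 := sq_nonneg (v 0)
  have s1 := sq_nonneg (v 1)
  constructor
  · have m0 : min (c₀ * κ) κ * J ≤ c₀ * κ * J := by gcongr; exact min_le_left _ _
    have m1 : min (c₀ * κ) κ * J ≤ κ * J := by gcongr; exact min_le_right _ _
    have := mul_le_mul_of_nonneg_right (m0.trans l0) s0
    have := mul_le_mul_of_nonneg_right (m1.trans l1) s1
    linarith
  · have t0 := mul_le_mul_of_nonneg_right u0 s0
    have t1 := mul_le_mul_of_nonneg_right u1 s1
    have t2 : 2 / (1 - m.rho ^ 2) * (v 0 ^ 2 + v 1 ^ 2)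
        ≤ 2 / (1 - m.rho ^ 2) * (v 0 ^ 2 + v 1 ^ 2) * J :=
      le_mul_of_one_le_right (by positivity) hJ
    have t3 : 0 ≤ K₀ * J * v 1 ^ 2 := by positivity
    have t4 : 0 ≤ A * J * v 0 ^ 2 := by positivity
    linarith

theorem expansion (h : m.Regular A κ J₁) (N : ℝ) :
    ∃ (c K : ℝ) (δ : ℕ → ℝ), 0 < c ∧ 0 < K ∧ Tendsto δ atTop (𝓝 0) ∧ ∀ᶠ J in atTop, ∀ ξ x,
      |ξ 0| ≤ N → |ξ 1| ≤ N → m.Typical J ξ x → |m.mode J x 0| ≤ N + 1 ∧ ∀ v : Trait,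
        m.logPost J x (m.mode J x + v) - m.logPost J x (m.mode J x)
          ≤ -(c * (J * hub (v 0) + J * hub (v 1))) ∧
        (|v 0| ≤ 1 → |m.logPost J x (m.mode J x + v) - m.logPost J x (m.mode J x)
          + dotProduct v ((m.postInfo J (m.mode J x)).mulVec v) / 2|
            ≤ J * v 0 ^ 2 * (δ J + K * |v 0|)) := by
  obtain ⟨c₀, hc₀, hrem⟩ := h.sum_accRem_le (N + 1)
  obtain ⟨K₁, hK₁, htay⟩ := h.abs_accRem_add_le (N + 1)
  obtain ⟨K₂, hK₂, hlip⟩ := h.lipschitz_curv (N + 1)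
  obtain ⟨η, hη, hclose⟩ := h.mode_close N
  have hκ := h.pos
  refine ⟨min c₀ (κ / 2), K₁, fun J => (rate J / J + K₂ * η J) / 2, by positivity, hK₁, ?_, ?_⟩
  · have := (tendsto_rate_div.add (hη.const_mul K₂)).div_const 2
    simpa using this
  filter_upwards [hclose, eventually_ge_atTop J₁, eventually_gt_atTop 0,
    hη.eventually_lt_const one_pos] with J hJc hJ₁ hJ0 hη1 ξ x h0 h1 hx
  have hJ : (0 : ℝ) < J := by exact_mod_cast hJ0
  obtain ⟨hw0, hw1⟩ := hJc ξ x h0 h1 hx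
  set w := m.mode J x
  have hwN : |w 0| ≤ N + 1 := by
    have := abs_sub_abs_le_abs_sub (w 0) (ξ 0)
    linarith
  refine ⟨hwN, fun v => ?_⟩
  rw [m.logPost_add_of_isMax h.rho hx.admissible (m.mode_isMax h.rho hx.admissible)]
  have hq := m.quad_nonneg h.rho v
  constructor
  · have b2 := hrem J hJ₁ x (w 0) (v 0) hwN
    have b3 : κ * J * v 1 ^ 2 ≤ (∑ j ∈ Finset.range J, m.cotInfo j) * v 1 ^ 2 :=
      mul_le_mul_of_nonneg_right (h.cot_growth J hJ₁) (sq_nonneg _)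
    have e0 := hub_nonneg (v 0)
    have e1 := hub_nonneg (v 1)
    have b5 : hub (v 1) ≤ v 1 ^ 2 := min_le_left _ _
    have c1 : min c₀ (κ / 2) * (J * hub (v 0)) ≤ c₀ * (J * hub (v 0)) := by
      gcongr
      exact min_le_left _ _
    have c2 : min c₀ (κ / 2) * (J * hub (v 1)) ≤ κ / 2 * (J * v 1 ^ 2) := by
      gcongr
      exact min_le_right _ _
    linarith
  · intro hv
    rw [quadForm_postInfo h.rho]
    set S₁ := ∑ j ∈ Finset.range J,
      (m.accRem j (x j).1 (w 0) (v 0) + m.accCurv j (x j).1 (w 0) * v 0 ^ 2 / 2)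
    set S₂ := ∑ j ∈ Finset.range J, (m.accInfo j (w 0) - m.accCurv j (x j).1 (w 0))
    have e : ∑ j ∈ Finset.range J, m.accRem j (x j).1 (w 0) (v 0)
        - (∑ j ∈ Finset.range J, m.cotInfo j) * v 1 ^ 2 / 2 - m.quad v / 2
        + ((∑ j ∈ Finset.range J, m.accInfo j (w 0)) * v 0 ^ 2
          + (∑ j ∈ Finset.range J, m.cotInfo j) * v 1 ^ 2 + m.quad v) / 2
        = S₁ + S₂ * (v 0 ^ 2 / 2) := by
      simp only [S₁, S₂, Finset.sum_add_distrib, Finset.sum_sub_distrib, ← Finset.sum_mul,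
        ← Finset.sum_div]
      ring
    rw [e]
    have hS₁ : |S₁| ≤ K₁ * |v 0| ^ 3 * J :=
      abs_sum_range_le (fun j => htay j _ _ _ hwN hv) J
    have hS₂ : |S₂| ≤ rate J + K₂ * η J * J := by
      have hd : |∑ j ∈ Finset.range J, ((m.accInfo j (w 0) - m.accCurv j (x j).1 (w 0))
          - (m.accInfo j (ξ 0) - m.accCurv j (x j).1 (ξ 0)))| ≤ K₂ * η J * J :=
        abs_sum_range_le (fun j => (hlip j _ _ _ hwN (by linarith)).trans
          (mul_le_mul_of_nonneg_left hw0 hK₂.le)) J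
      rw [Finset.sum_sub_distrib] at hd
      have := abs_sub_abs_le_abs_sub S₂
        (∑ j ∈ Finset.range J, (m.accInfo j (ξ 0) - m.accCurv j (x j).1 (ξ 0)))
      linarith [hx.curv]
    have hs : |S₂ * (v 0 ^ 2 / 2)| ≤ (rate J + K₂ * η J * J) * (v 0 ^ 2 / 2) := by
      rw [abs_mul, abs_of_nonneg (by positivity : 0 ≤ v 0 ^ 2 / 2)]
      exact mul_le_mul_of_nonneg_right hS₂ (by positivity)
    have e2 : J * v 0 ^ 2 * ((rate J / J + K₂ * η J) / 2 + K₁ * |v 0|)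
        = K₁ * |v 0| ^ 3 * J + (rate J + K₂ * η J * J) * (v 0 ^ 2 / 2) := by
      have e3 : |v 0| ^ 3 = v 0 ^ 2 * |v 0| := by rw [← sq_abs (v 0)]; ring
      rw [e3]
      field_simp
      ring
    rw [e2]
    exact (abs_add_le _ _).trans (add_le_add hS₁ hs)

end Regular

open scoped MatrixOrder in
theorem sqrtPostInfo_spec {J : ℕ} {ξ : Trait} (hρ : |m.rho| < 1) {c : ℝ} (hc : 0 < c)
    (hpos : ∀ v : Trait, c * (v 0 ^ 2 + v 1 ^ 2) ≤ dotProduct v ((m.postInfo J ξ).mulVec v)) :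
    (m.sqrtPostInfo J ξ).det ≠ 0 ∧ ∀ u : Trait,
      dotProduct ((m.sqrtPostInfo J ξ)⁻¹.mulVec u)
        ((m.postInfo J ξ).mulVec ((m.sqrtPostInfo J ξ)⁻¹.mulVec u)) = u 0 ^ 2 + u 1 ^ 2 := by
  have hherm : (m.postInfo J ξ).IsHermitian := by
    rw [m.postInfo_eq hρ]
    ext i k
    fin_cases i <;> fin_cases k <;> simp
  have hPD : (m.postInfo J ξ).PosDef := by
    refine Matrix.PosDef.of_dotProduct_mulVec_pos hherm fun v hv => ?_
    have h1 : v 0 ≠ 0 ∨ v 1 ≠ 0 := by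
      by_contra! h0
      exact hv (funext fun i => by fin_cases i; exacts [h0.1, h0.2])
    have h2 : 0 < v 0 ^ 2 + v 1 ^ 2 := by
      rcases h1 with h1 | h1 <;> positivity
    have := (mul_pos hc h2).trans_le (hpos v)
    simpa using this
  have hnn : 0 ≤ m.postInfo J ξ := hPD.posSemidef.nonneg
  set S := m.sqrtPostInfo J ξ
  have hSS : S * S = m.postInfo J ξ := CFC.sqrt_mul_sqrt_self _ hnn
  have hSH : S.transpose = S := by
    have h0 : (0 : Matrix (Fin 2) (Fin 2) ℝ) ≤ S := CFC.sqrt_nonneg _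
    simpa using (Matrix.nonneg_iff_posSemidef.1 h0).isHermitian.eq
  have hdet : S.det ≠ 0 := fun h0 => by
    have := hPD.det_pos
    rw [← hSS, Matrix.det_mul, h0] at this
    simp at this
  refine ⟨hdet, fun u => ?_⟩
  set v := S⁻¹.mulVec u
  have hSv : S.mulVec v = u := by
    rw [Matrix.mulVec_mulVec, Matrix.mul_nonsing_inv _ (isUnit_iff_ne_zero.2 hdet),
      Matrix.one_mulVec]
  rw [← hSS, ← Matrix.mulVec_mulVec, hSv, Matrix.dotProduct_mulVec, ← Matrix.mulVec_transpose,
    hSH, hSv]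
  simp [dotProduct, Fin.sum_univ_two, sq]

theorem abs_add_abs_le_of_quad_le {K J v₀ v₁ u₀ u₁ : ℝ} (hK : 1 ≤ K) (hJ : 1 ≤ J)
    (h : u₀ ^ 2 + u₁ ^ 2 ≤ K * J * (v₀ ^ 2 + v₁ ^ 2)) :
    (|u₀| + |u₁|) / (2 * K) - 2 ≤ J * hub v₀ + J * hub v₁ := by
  set s := Real.sqrt J
  have hs : s ^ 2 = J := Real.sq_sqrt (by linarith)
  have hs1 : 1 ≤ s := Real.one_le_sqrt.2 hJ
  have key : ∀ y : ℝ, s * |y| - 1 ≤ J * hub y := fun y => by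
    rw [hub, mul_min_of_nonneg _ _ (by linarith), ← sq_abs y, ← hs]
    have := abs_nonneg y
    refine le_min ?_ ?_
    · nlinarith [sq_nonneg (s * |y| - 1), mul_nonneg (by linarith : 0 ≤ s) this]
    · nlinarith [mul_nonneg (mul_nonneg (by linarith : 0 ≤ s) (sub_nonneg.2 hs1)) this]
  have h2 : (|u₀| + |u₁|) / (2 * K) ≤ s * |v₀| + s * |v₁| := by
    have a0 := abs_nonneg v₀
    have a1 := abs_nonneg v₁
    have hs0 : 0 ≤ s := by linarith
    refine le_of_sq_le_sq ?_ (by positivity)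
    rw [div_pow, div_le_iff₀ (by positivity)]
    rw [← sq_abs u₀, ← sq_abs u₁, ← sq_abs v₀, ← sq_abs v₁, ← hs] at h
    have h3 : (|u₀| + |u₁|) ^ 2 ≤ 2 * (|u₀| ^ 2 + |u₁| ^ 2) := by
      nlinarith [sq_nonneg (|u₀| - |u₁|)]
    have h4 : s ^ 2 * (|v₀| ^ 2 + |v₁| ^ 2) ≤ (s * |v₀| + s * |v₁|) ^ 2 := by
      have : 0 ≤ s * |v₀| * (s * |v₁|) := by positivity
      nlinarith
    have h5 : 2 * K ≤ (2 * K) ^ 2 := by nlinarith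
    have h6 := mul_le_mul_of_nonneg_left h4 (by linarith : 0 ≤ 2 * K)
    have h7 := mul_le_mul_of_nonneg_right h5 (sq_nonneg (s * |v₀| + s * |v₁|))
    nlinarith
  linarith [key v₀, key v₁]

/-- The Bernstein–von Mises limit along typical data. -/
theorem Regular.tendsto_postProb (h : m.Regular A κ J₁) (N : ℝ) {ι : Type*} {l : Filter ι}
    [l.IsCountablyGenerated] {J : ι → ℕ} {ξ : ι → Trait} {x : ι → Data} (hJ : Tendsto J l atTop)
    (hx : ∀ᶠ k in l, |ξ k 0| ≤ N ∧ |ξ k 1| ≤ N ∧ m.Typical (J k) (ξ k) (x k))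
    {B : Set Trait} (hB : MeasurableSet B) :
    Tendsto (fun k => m.postProb B (J k) (x k)) l (𝓝 (stdNormal₂.real B)) := by
  obtain ⟨c, K, δ, hc, hK, hδ, hexp⟩ := h.expansion N
  obtain ⟨c', K', hc', hK', hqf⟩ := h.quadForm_bounds (N + 1)
  set w : ι → Trait := fun k => m.mode (J k) (x k)
  set S : ι → Matrix (Fin 2) (Fin 2) ℝ := fun k => m.sqrtPostInfo (J k) (w k)
  set v : ι → Trait → Trait := fun k u => (S k)⁻¹.mulVec u
  set Q : ι → Trait → ℝ := fun k u =>
    m.logPost (J k) (x k) (w k + v k u) - m.logPost (J k) (x k) (w k)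
  have ev : ∀ᶠ k in l, (S k).det ≠ 0 ∧ Admissible (J k) (x k) ∧ 1 ≤ (J k : ℝ) ∧ ∀ u,
      c' * J k * (v k u 0 ^ 2 + v k u 1 ^ 2) ≤ u 0 ^ 2 + u 1 ^ 2 ∧
      u 0 ^ 2 + u 1 ^ 2 ≤ K' * J k * (v k u 0 ^ 2 + v k u 1 ^ 2) ∧
      Q k u ≤ -(c * (J k * hub (v k u 0) + J k * hub (v k u 1))) ∧
      (|v k u 0| ≤ 1 → |Q k u + (u 0 ^ 2 + u 1 ^ 2) / 2|
        ≤ J k * v k u 0 ^ 2 * (δ (J k) + K * |v k u 0|)) := by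
    filter_upwards [hx, hJ.eventually hexp, hJ.eventually (eventually_ge_atTop J₁),
      hJ.eventually (eventually_gt_atTop 0)] with k hk hke hk₁ hk0
    obtain ⟨hwN, hv⟩ := hke (ξ k) (x k) hk.1 hk.2.1 hk.2.2
    have hJ0 : (0 : ℝ) < J k := by exact_mod_cast hk0
    obtain ⟨hdet, hSq⟩ := sqrtPostInfo_spec h.rho (mul_pos hc' hJ0)
      fun v => (hqf (J k) hk₁ hk0 (w k) v hwN).1
    refine ⟨hdet, hk.2.2.admissible, by exact_mod_cast hk0, fun u => ?_⟩
    have hq := hqf (J k) hk₁ hk0 (w k) (v k u) hwN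
    have he := hv (v k u)
    rw [hSq u] at hq he
    exact ⟨hq.1, hq.2, he.1, he.2⟩
  refine (tendsto_ratio_gauss (Q := Q) (c := c / (2 * K')) (C := 2 * c) (by positivity)
    ?_ ?_ ?_ hB).congr' ?_
  · filter_upwards [ev] with k hk
    have hlp := m.continuous_logPost h.rho hk.2.1
    have hv : Continuous (v k) := by
      have : Continuous fun u : Trait => (S k)⁻¹.mulVec u := by fun_prop
      exact this
    exact (hlp.comp (continuous_const.add hv)).sub continuous_const
  · filter_upwards [ev] with k hk u
    obtain ⟨-, hu2, hu3, -⟩ := hk.2.2.2 u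
    have := mul_le_mul_of_nonneg_left (abs_add_abs_le_of_quad_le hK' hk.2.2.1 hu2) hc.le
    have e : c / (2 * K') * (|u 0| + |u 1|) = c * ((|u 0| + |u 1|) / (2 * K')) := by ring
    rw [e]
    linarith
  · intro u
    set s := u 0 ^ 2 + u 1 ^ 2
    have hs : 0 ≤ s := by positivity
    have hJr : Tendsto (fun k => (J k : ℝ)) l atTop := tendsto_natCast_atTop_atTop.comp hJ
    have hbound : ∀ᶠ k in l, |v k u 0| ≤ Real.sqrt (s / c' / J k) ∧
        J k * v k u 0 ^ 2 ≤ s / c' := by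
      filter_upwards [ev] with k hk
      obtain ⟨hu1, -⟩ := hk.2.2.2 u
      have hJ0 : (0 : ℝ) < J k := by linarith [hk.2.2.1]
      have h1 : J k * v k u 0 ^ 2 ≤ s / c' := by
        rw [le_div_iff₀ hc']
        have : 0 ≤ c' * J k * v k u 1 ^ 2 := by positivity
        linarith
      refine ⟨Real.abs_le_sqrt ?_, h1⟩
      rw [le_div_iff₀ hJ0]
      linarith
    have hv0 : Tendsto (fun k => Real.sqrt (s / c' / J k)) l (𝓝 0) := by
      have := (hJr.const_div_atTop (s / c')).sqrt
      simpa using this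
    have hlim : Tendsto (fun k => s / c' * (|δ (J k)| + K * Real.sqrt (s / c' / J k))) l
        (𝓝 0) := by
      have := (((hδ.comp hJ).abs).add (hv0.const_mul K)).const_mul (s / c')
      simpa using this
    have hdiff : Tendsto (fun k => Q k u + s / 2) l (𝓝 0) := by
      refine squeeze_zero_norm' ?_ hlim
      filter_upwards [ev, hbound, hv0.eventually_lt_const one_pos] with k hk hb hv1
      obtain ⟨-, -, -, hu4⟩ := hk.2.2.2 u
      refine (hu4 (hb.1.trans hv1.le)).trans ?_
      have hJ0 : (0 : ℝ) < J k := by linarith [hk.2.2.1]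
      calc J k * v k u 0 ^ 2 * (δ (J k) + K * |v k u 0|)
          ≤ J k * v k u 0 ^ 2 * (|δ (J k)| + K * Real.sqrt (s / c' / J k)) := by
            gcongr
            · exact le_abs_self _
            · exact hb.1
        _ ≤ s / c' * (|δ (J k)| + K * Real.sqrt (s / c' / J k)) := by
            gcongr
            exact hb.2
    have := hdiff.sub_const (s / 2)
    simp only [add_sub_cancel_right, zero_sub] at this
    rwa [neg_div]
  · filter_upwards [ev] with k hk
    exact (m.postProb_eq h.rho hk.2.1 hk.1 hB fun u => rfl).symm

/-! ### Typical data have probability close to one -/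

theorem rate_pos {J : ℕ} (hJ : 0 < J) : 0 < rate J :=
  Real.rpow_pos_of_pos (by exact_mod_cast hJ) _

theorem tendsto_div_rate_sq (K : ℝ) :
    Tendsto (fun J : ℕ => ENNReal.ofReal (K * J / rate J ^ 2)) atTop (𝓝 0) := by
  have h := ((tendsto_rpow_neg_atTop (y := 1 / 2) (by norm_num)).comp
    tendsto_natCast_atTop_atTop).const_mul K
  have h2 : Tendsto (fun J : ℕ => K * J / rate J ^ 2) atTop (𝓝 0) := by
    rw [mul_zero] at h
    refine h.congr' ?_
    filter_upwards [eventually_gt_atTop 0] with J hJ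
    have hJ' : (0 : ℝ) < J := by exact_mod_cast hJ
    have e : rate J ^ 2 = (J : ℝ) * (J : ℝ) ^ (1 / 2 : ℝ) := by
      rw [rate, ← Real.rpow_natCast, ← Real.rpow_mul hJ'.le]
      nth_rw 2 [← Real.rpow_one (J : ℝ)]
      rw [← Real.rpow_add hJ']
      norm_num
    have := (Real.rpow_pos_of_pos hJ' (1 / 2)).ne'
    rw [Function.comp_apply, e, Real.rpow_neg hJ'.le]
    field_simp
  simpa using ENNReal.tendsto_ofReal h2

/-- Chebyshev's inequality for sums over items. -/
theorem dataLaw_abs_sum_gt_le {ξ : Trait} {f : ℕ → Bool × ℝ → ℝ} (hf : ∀ j, Measurable (f j))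
    (h2 : ∀ j, MemLp (fun x : Data => f j (x j)) 2 (m.dataLaw ξ))
    (h0 : ∀ j, ∫ x, f j (x j) ∂(m.dataLaw ξ) = 0) {K : ℝ}
    (hv : ∀ j, variance (fun x : Data => f j (x j)) (m.dataLaw ξ) ≤ K) {J : ℕ} (hJ : 0 < J) :
    m.dataLaw ξ {x | ¬ |∑ j ∈ Finset.range J, f j (x j)| ≤ rate J}
      ≤ ENNReal.ofReal (K * J / rate J ^ 2) := by
  have hind : iIndepFun (fun j (x : Data) => f j (x j)) (m.dataLaw ξ) :=
    iIndepFun_infinitePi (X := f) hf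
  have hsum : MemLp (∑ j ∈ Finset.range J, fun x : Data => f j (x j)) 2 (m.dataLaw ξ) :=
    memLp_finsetSum' _ fun j _ => h2 j
  have hvar : variance (∑ j ∈ Finset.range J, fun x : Data => f j (x j)) (m.dataLaw ξ)
      ≤ K * J := by
    rw [IndepFun.variance_sum (fun j _ => h2 j) fun i _ j _ hij => hind.indepFun hij]
    refine (Finset.sum_le_sum fun j _ => hv j).trans ?_
    simp [mul_comm]
  have hmean : ∫ x, (∑ j ∈ Finset.range J, fun x : Data => f j (x j)) x ∂(m.dataLaw ξ) = 0 := by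
    simp only [Finset.sum_apply]
    rw [integral_finsetSum _ fun j _ => (h2 j).integrable one_le_two]
    simp [h0]
  have hcheb := meas_ge_le_variance_div_sq hsum (rate_pos hJ)
  rw [hmean] at hcheb
  refine (measure_mono fun x hx => ?_).trans (hcheb.trans (ENNReal.ofReal_le_ofReal ?_))
  · have := (not_le.1 hx).le
    simpa using this
  · have := rate_pos hJ
    gcongr

theorem Regular.dataLaw_not_typical_le (h : m.Regular A κ J₁) (N : ℝ) :
    ∃ β : ℕ → ℝ≥0∞, Tendsto β atTop (𝓝 0) ∧ ∀ J, 0 < J → ∀ ξ : Trait, |ξ 0| ≤ N →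
      m.dataLaw ξ {x | ¬ m.Typical J ξ x} ≤ β J := by
  obtain ⟨K₁, hK₁, hb1⟩ := h.abs_accScore_le N
  obtain ⟨K₂, hK₂, hb2⟩ := h.abs_accInfo_sub_le N
  refine ⟨fun J => ENNReal.ofReal (K₁ ^ 2 * J / rate J ^ 2) + ENNReal.ofReal (A * J / rate J ^ 2)
    + ENNReal.ofReal (K₂ ^ 2 * J / rate J ^ 2), ?_, fun J hJ ξ hξ => ?_⟩
  · simpa using ((tendsto_div_rate_sq (K₁ ^ 2)).add (tendsto_div_rate_sq A)).add
      (tendsto_div_rate_sq (K₂ ^ 2))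
  have hacc : ∀ (f : ℕ → Bool → ℝ) (K : ℝ), (∀ j r, |f j r| ≤ K) →
      (∀ j, ∫ x, f j (x j).1 ∂(m.dataLaw ξ) = 0) →
      m.dataLaw ξ {x | ¬ |∑ j ∈ Finset.range J, f j (x j).1| ≤ rate J}
        ≤ ENNReal.ofReal (K ^ 2 * J / rate J ^ 2) := fun f K hK h0 => by
    have hfm : ∀ j, Measurable fun p : Bool × ℝ => f j p.1 := fun j =>
      (measurable_of_finite (f j)).comp measurable_fst
    refine dataLaw_abs_sum_gt_le (f := fun j p => f j p.1) hfm (fun j => ?_) h0 (fun j => ?_) hJ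
    · exact MemLp.of_bound ((hfm j).comp (measurable_pi_apply j)).aestronglyMeasurable K
        (ae_of_all _ fun x => hK j _)
    · refine (variance_le_sq_of_bounded (a := -K) (b := K)
        (ae_of_all _ fun x => abs_le.1 (hK j _))
        ((hfm j).comp (measurable_pi_apply j)).aemeasurable).trans (le_of_eq ?_)
      ring
  have e1 := hacc (fun j r => m.accScore j r (ξ 0)) K₁ (fun j r => hb1 j r _ hξ)
    fun j => m.integral_accScore ξ j
  have e3 := hacc (fun j r => m.accInfo j (ξ 0) - m.accCurv j r (ξ 0)) K₂
    (fun j r => hb2 j r _ hξ) fun j => by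
      rw [integral_sub (integrable_const _) (m.integrable_acc ξ j fun r => m.accCurv j r (ξ 0)),
        m.integral_accCurv]
      simp
  have e2 : m.dataLaw ξ {x | ¬ |∑ j ∈ Finset.range J, m.cotScore j (x j).2 (ξ 1)| ≤ rate J}
      ≤ ENNReal.ofReal (A * J / rate J ^ 2) := by
    have hlaw : ∀ j, HasLaw (fun x : Data => m.cotScore j (x j).2 (ξ 1))
        (gaussianReal 0 (.mk ((m.vphi j / m.lam j) ^ 2) (sq_nonneg _) * m.lam j))
        (m.dataLaw ξ) := fun j => by
      have h1 : HasLaw (fun x : Data => Real.log (x j).2)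
          (gaussianReal (m.omega j - m.vphi j * ξ 1) (m.lam j)) (m.dataLaw ξ) :=
        ⟨(Real.measurable_log.comp (measurable_cot j)).aemeasurable, m.map_log_dataLaw ξ j⟩
      have h2 := gaussianReal_const_mul (gaussianReal_sub_const h1
        (m.omega j - m.vphi j * ξ 1)) (-(m.vphi j / m.lam j))
      simp only [sub_self, mul_zero, neg_sq] at h2
      convert h2 using 2
      simp only [cotScore]
      ring
    have hfm : ∀ j, Measurable fun p : Bool × ℝ => m.cotScore j p.2 (ξ 1) := fun j => by
      unfold cotScore
      fun_prop
    refine dataLaw_abs_sum_gt_le (f := fun j p => m.cotScore j p.2 (ξ 1)) hfm (fun j => ?_)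
      (fun j => ?_) (fun j => ?_) hJ
    · have := (memLp_id_gaussianReal' (μ := 0)
        (v := .mk ((m.vphi j / m.lam j) ^ 2) (sq_nonneg _) * m.lam j) 2 (by simp))
      rw [← (hlaw j).map_eq] at this
      exact this.comp_of_map (hlaw j).aemeasurable
    · rw [(hlaw j).integral_eq]
      exact integral_id_gaussianReal
    · rw [(hlaw j).variance_eq, variance_id_gaussianReal]
      refine le_trans (le_of_eq ?_) (h.cot_le j)
      have := (m.lam_pos' j).ne'
      simp [cotInfo]
      field_simp
  have e0 : m.dataLaw ξ {x | ¬ Admissible J x} = 0 := m.ae_admissible ξ J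
  refine (measure_mono fun x hx => ?_).trans ((measure_union_le
    ({x | ¬ |∑ j ∈ Finset.range J, m.accScore j (x j).1 (ξ 0)| ≤ rate J}
      ∪ {x | ¬ |∑ j ∈ Finset.range J, m.cotScore j (x j).2 (ξ 1)| ≤ rate J}
      ∪ {x | ¬ |∑ j ∈ Finset.range J, (m.accInfo j (ξ 0) - m.accCurv j (x j).1 (ξ 0))| ≤ rate J})
    {x | ¬ Admissible J x}).trans ?_)
  · by_contra hcon
    simp only [Set.mem_union, Set.mem_ofPred_eq, not_or, not_not] at hcon
    exact hx ⟨hcon.2, hcon.1.1.1, hcon.1.1.2, hcon.1.2⟩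
  · rw [e0, add_zero]
    exact (measure_union_le _ _).trans (add_le_add
      ((measure_union_le _ _).trans (add_le_add e1 e2)) e3)

theorem measurableSet_not_typical (m : Params) (J : ℕ) :
    MeasurableSet {p : Trait × Data | ¬ m.Typical J p.1 p.2} := by
  have hr : ∀ j, Measurable fun p : Trait × Data => (p.2 j).1 := fun j =>
    (measurable_acc j).comp measurable_snd
  have ht : ∀ j, Measurable fun p : Trait × Data => (p.2 j).2 := fun j =>
    (measurable_cot j).comp measurable_snd
  have hs : ∀ j, Measurable fun p : Trait × Data => sgn (p.2 j).1 := fun j =>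
    (measurable_of_finite sgn).comp (hr j)
  have hξ : ∀ i, Measurable fun p : Trait × Data => p.1 i := fun i =>
    (measurable_pi_apply i).comp measurable_fst
  have hz : ∀ j, Measurable fun p : Trait × Data => m.arg j (p.2 j).1 (p.1 0) := fun j =>
    (hs j).mul (((hξ 0).const_mul _).add_const _)
  have h1 : Measurable fun p : Trait × Data => |∑ j ∈ Finset.range J,
      m.accScore j (p.2 j).1 (p.1 0)| :=
    continuous_abs.measurable.comp (Finset.measurable_fun_sum _ fun j _ =>
      ((hs j).mul_const _).mul (contDiff_score.continuous.measurable.comp (hz j)))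
  have h2 : Measurable fun p : Trait × Data => |∑ j ∈ Finset.range J,
      m.cotScore j (p.2 j).2 (p.1 1)| :=
    continuous_abs.measurable.comp (Finset.measurable_fun_sum _ fun j _ =>
      (((Real.measurable_log.comp (ht j)).sub_const _).add ((hξ 1).const_mul _)).const_mul _)
  have h3 : Measurable fun p : Trait × Data => |∑ j ∈ Finset.range J,
      (m.accInfo j (p.1 0) - m.accCurv j (p.2 j).1 (p.1 0))| := by
    simp only [accInfo_eq]
    exact continuous_abs.measurable.comp (Finset.measurable_fun_sum _ fun j _ =>
      ((contDiff_binInfo.continuous.measurable.comp (((hξ 0).const_mul _).add_const _)).const_mul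
        _).sub ((contDiff_curv.continuous.measurable.comp (hz j)).const_mul _))
  have h0 : MeasurableSet {p : Trait × Data | Admissible J p.2} := by
    have : {p : Trait × Data | Admissible J p.2} = ⋂ j, ⋂ (_ : j < J), {p | 0 < (p.2 j).2} := by
      ext p; simp [Admissible]
    rw [this]
    exact MeasurableSet.iInter fun j => MeasurableSet.iInter fun _ =>
      measurableSet_lt measurable_const (ht j)
  have e : {p : Trait × Data | ¬ m.Typical J p.1 p.2}
      = ({p | Admissible J p.2} ∩ {p | |∑ j ∈ Finset.range J,
          m.accScore j (p.2 j).1 (p.1 0)| ≤ rate J}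
        ∩ {p | |∑ j ∈ Finset.range J, m.cotScore j (p.2 j).2 (p.1 1)| ≤ rate J}
        ∩ {p | |∑ j ∈ Finset.range J,
          (m.accInfo j (p.1 0) - m.accCurv j (p.2 j).1 (p.1 0))| ≤ rate J})ᶜ := by
    ext p
    simp only [Set.mem_ofPred_eq, Set.mem_compl_iff, Set.mem_inter_iff, not_iff_not]
    exact ⟨fun h => ⟨⟨⟨h.1, h.2⟩, h.3⟩, h.4⟩, fun h => ⟨h.1.1.1, h.1.1.2, h.1.2, h.2⟩⟩
  rw [e]
  exact (((h0.inter (measurableSet_le h1 measurable_const)).inter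
    (measurableSet_le h2 measurable_const)).inter (measurableSet_le h3 measurable_const)).compl

/-! ### Regularity from the assumptions -/

theorem exists_sum_le_of_limsupAvg_le {u : ℕ → ℝ} {c : ℝ} (hc : c < 0)
    (hu : limsupAvg u ≤ (c : EReal)) :
    ∃ κ, 0 < κ ∧ ∀ᶠ J : ℕ in atTop, ∑ j ∈ Finset.range J, u j ≤ -(κ * J) := by
  refine ⟨-c / 2, by linarith, ?_⟩
  have hlt : limsupAvg u < ((c / 2 : ℝ) : EReal) :=
    hu.trans_lt (EReal.coe_lt_coe_iff.2 (by linarith))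
  filter_upwards [eventually_lt_of_limsup_lt hlt, eventually_gt_atTop 0] with J hJ hJ0
  have hJ' : (0 : ℝ) < J := by exact_mod_cast hJ0
  have h := EReal.coe_lt_coe_iff.1 hJ
  rw [one_div, inv_mul_lt_iff₀ hJ'] at h
  linarith

theorem cotGap_eq (j : ℕ) (τ₀ τ : ℝ) : m.cotGap j τ₀ τ = -(m.cotInfo j * (τ - τ₀) ^ 2 / 2) := by
  have := (m.lam_pos' j).ne'
  simp only [cotGap, cotInfo]
  field_simp
  ring

theorem accGap_eq (j : ℕ) (θ₀ θ : ℝ) : m.accGap j θ₀ θ =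
    Phi (m.a j * θ₀ + m.b j) * logPhiRem (m.a j * θ₀ + m.b j) (m.a j * (θ - θ₀))
    + (1 - Phi (m.a j * θ₀ + m.b j))
      * logPhiRem (-(m.a j * θ₀ + m.b j)) (-(m.a j * (θ - θ₀))) := by
  have h := mean_score (m.a j * θ₀ + m.b j)
  have e1 : -m.a j * θ₀ - m.b j = -(m.a j * θ₀ + m.b j) := by ring
  have e2 : -m.a j * θ - m.b j = -(m.a j * θ₀ + m.b j) + -(m.a j * (θ - θ₀)) := by ring
  have e3 : m.a j * θ + m.b j = m.a j * θ₀ + m.b j + m.a j * (θ - θ₀) := by ring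
  rw [accGap, e1, e2, e3, Real.log_div (Phi_pos _).ne' (Phi_pos _).ne',
    Real.log_div (Phi_pos _).ne' (Phi_pos _).ne', Phi_neg (m.a j * θ₀ + m.b j)]
  simp only [logPhiRem, Phi_neg (m.a j * θ₀ + m.b j)]
  linear_combination (m.a j * (θ - θ₀)) * h

theorem exists_bound_of_boundedItems (hb : m.BoundedItems) :
    ∃ A, 1 ≤ A ∧ (∀ j, |m.a j| ≤ A) ∧ (∀ j, |m.b j| ≤ A) ∧ ∀ j, m.cotInfo j ≤ A := by
  obtain ⟨hK, C, hC⟩ := hb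
  obtain ⟨-, d₀, d₁, hd₀, -, hd₁, hd⟩ := hK (Set.Icc 0 1) isCompact_Icc
  obtain ⟨Z₀, hZ₀⟩ := ((tendsto_cdf_atBot (gaussianReal 0 1)).eventually_lt_const hd₀).exists
  obtain ⟨Z₁, hZ₁⟩ := ((tendsto_cdf_atTop (gaussianReal 0 1)).eventually_const_lt hd₁).exists
  have key : ∀ z, d₀ ≤ Phi z → Phi z ≤ d₁ → |z| ≤ |Z₀| + |Z₁| := fun z h0 h1 => by
    have l0 : Z₀ < z := strictMono_Phi.lt_iff_lt.1 (hZ₀.trans_le h0)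
    have l1 : z < Z₁ := strictMono_Phi.lt_iff_lt.1 (h1.trans_lt hZ₁)
    rw [abs_le]
    have := neg_abs_le Z₀
    have := le_abs_self Z₁
    have := abs_nonneg Z₀
    have := abs_nonneg Z₁
    constructor <;> linarith
  set Z := |Z₀| + |Z₁|
  have hb' : ∀ j, |m.b j| ≤ Z := fun j => by
    have := hd j 0 (by simp)
    simp only [mul_zero, zero_add] at this
    exact key _ this.1 this.2
  have hab : ∀ j, |m.a j + m.b j| ≤ Z := fun j => by
    have := hd j 1 (by simp)
    simp only [mul_one] at this
    exact key _ this.1 this.2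
  have hZ : 0 ≤ Z := by positivity
  refine ⟨max (max 1 (2 * Z)) C, (le_max_left _ _).trans (le_max_left _ _), fun j => ?_,
    fun j => ?_, fun j => (hC j).trans (le_max_right _ _)⟩
  · refine le_trans ?_ ((le_max_right _ _).trans (le_max_left _ _))
    have := abs_sub (m.a j + m.b j) (m.b j)
    rw [add_sub_cancel_right] at this
    linarith [hab j, hb' j]
  · refine le_trans ?_ ((le_max_right _ _).trans (le_max_left _ _))
    linarith [hb' j]

theorem exists_regular (hb : m.BoundedItems) {ξ₀ : Trait} (hi : m.Identifiable ξ₀)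
    (hn : m.NonDegenerate ξ₀) : ∃ A κ J₁, m.Regular A κ J₁ := by
  obtain ⟨A, hA, ha, hb', hcot⟩ := exists_bound_of_boundedItems hb
  obtain ⟨c₁, c₂, h1, h2, -⟩ := hi
  obtain ⟨hc1, hl1⟩ := h1 (ξ₀ 0 + 1) (by simp)
  obtain ⟨hc2, hl2⟩ := h2 (ξ₀ 1 + 1) (by simp)
  obtain ⟨κ₁, hκ₁, hs1⟩ := exists_sum_le_of_limsupAvg_le hc1 hl1
  obtain ⟨κ₂, hκ₂, hs2⟩ := exists_sum_le_of_limsupAvg_le hc2 hl2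
  have hA0 : 0 ≤ A := zero_le_one.trans hA
  obtain ⟨K, hK, hrem⟩ := exists_le_logPhiRem (A * |ξ₀ 0| + A)
  have hz : ∀ j, |m.a j * ξ₀ 0 + m.b j| ≤ A * |ξ₀ 0| + A := fun j => by
    refine (abs_add_le _ _).trans (add_le_add ?_ (hb' j))
    rw [abs_mul]
    exact mul_le_mul_of_nonneg_right (ha j) (abs_nonneg _)
  have hy : ∀ j, |m.a j| ≤ A * |ξ₀ 0| + A := fun j => by
    have := mul_nonneg hA0 (abs_nonneg (ξ₀ 0))
    linarith [ha j]
  have hgap : ∀ j, -(K * m.a j ^ 2) ≤ m.accGap j (ξ₀ 0) (ξ₀ 0 + 1) := fun j => by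
    rw [accGap_eq, add_sub_cancel_left, mul_one]
    have r1 := hrem _ _ (hz j) (hy j)
    have r2 := hrem (-(m.a j * ξ₀ 0 + m.b j)) (-m.a j) (by rw [abs_neg]; exact hz j)
      (by rw [abs_neg]; exact hy j)
    rw [neg_sq] at r2
    have p1 := mul_le_mul_of_nonneg_left r1 (Phi_pos (m.a j * ξ₀ 0 + m.b j)).le
    have p2 := mul_le_mul_of_nonneg_left r2 (sub_nonneg.2 (Phi_lt_one (m.a j * ξ₀ 0 + m.b j)).le)
    linarith
  obtain ⟨J₁, hJ₁⟩ := eventually_atTop.1 (hs1.and hs2)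
  refine ⟨A, min (κ₁ / K) (2 * κ₂), J₁, hn.2.2, hA, ha, hb', hcot, by positivity, fun J hJ => ?_,
    fun J hJ => ?_⟩
  · have hs := (Finset.sum_le_sum fun j _ => hgap j).trans (hJ₁ J hJ).1
    rw [Finset.sum_neg_distrib, neg_le_neg_iff, ← Finset.mul_sum] at hs
    refine (mul_le_mul_of_nonneg_right (min_le_left _ _) J.cast_nonneg).trans ?_
    rw [div_mul_eq_mul_div, div_le_iff₀ hK]
    linarith
  · have hs := (hJ₁ J hJ).2
    simp only [cotGap_eq, add_sub_cancel_left, one_pow, mul_one, Finset.sum_neg_distrib,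
      ← Finset.sum_div] at hs
    refine (mul_le_mul_of_nonneg_right (min_le_right _ _) J.cast_nonneg).trans ?_
    linarith

/-! ### Convergence in probability -/

theorem Regular.eventually_postProb_close (h : m.Regular A κ J₁) (N : ℝ) {B : Set Trait}
    (hB : MeasurableSet B) {ε : ℝ≥0∞} (hε : 0 < ε) :
    ∀ᶠ J in atTop, ∀ ξ x, |ξ 0| ≤ N → |ξ 1| ≤ N → m.Typical J ξ x →
      edist (m.postProb B J x) (stdNormal₂.real B) < ε := by
  set good : Set (ℕ × Trait × Data) :=
    {p | |p.2.1 0| ≤ N ∧ |p.2.1 1| ≤ N ∧ m.Typical p.1 p.2.1 p.2.2}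
  have ht := h.tendsto_postProb N (l := comap Prod.fst atTop ⊓ 𝓟 good) (J := fun p => p.1)
    (ξ := fun p => p.2.1) (x := fun p => p.2.2) (tendsto_comap.mono_left inf_le_left)
    (mem_inf_of_right (mem_principal_self good)) hB
  have he := (EMetric.tendsto_nhds.1 ht) ε hε
  rw [eventually_inf_principal, eventually_comap] at he
  filter_upwards [he] with J hJ ξ x h0 h1 hx
  exact hJ (J, ξ, x) rfl ⟨h0, h1, hx⟩

theorem Regular.tendstoInMeasure_dataLaw (h : m.Regular A κ J₁) (ξ₀ : Trait) {B : Set Trait}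
    (hB : MeasurableSet B) :
    TendstoInMeasure (m.dataLaw ξ₀) (fun J x => m.postProb B J x) atTop
      (fun _ => stdNormal₂.real B) := by
  intro ε hε
  obtain ⟨β, hβ, hle⟩ := h.dataLaw_not_typical_le (max |ξ₀ 0| |ξ₀ 1|)
  refine tendsto_of_tendsto_of_tendsto_of_le_of_le' tendsto_const_nhds hβ
    (Eventually.of_forall fun _ => zero_le) ?_
  filter_upwards [h.eventually_postProb_close (max |ξ₀ 0| |ξ₀ 1|) hB hε, eventually_gt_atTop 0]
    with J hJ hJ0
  refine (measure_mono fun x hx => ?_).trans (hle J hJ0 ξ₀ (le_max_left _ _))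
  intro ht
  exact absurd (hJ ξ₀ x (le_max_left _ _) (le_max_right _ _) ht) (not_lt.2 hx)

theorem Regular.tendstoInMeasure_compProd (h : m.Regular A κ J₁) (G : Measure Trait)
    [IsProbabilityMeasure G] {B : Set Trait} (hB : MeasurableSet B) :
    TendstoInMeasure (G.compProd m.dataKernel)
      (fun J (p : Trait × Data) => m.postProb B J p.2) atTop (fun _ => stdNormal₂.real B) := by
  intro ε hε
  set out : ℕ → Set Trait := fun n => {ξ | (n : ℝ) < max |ξ 0| |ξ 1|}
  have hnorm : Measurable fun ξ : Trait => max |ξ 0| |ξ 1| := by fun_prop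
  have hout : ∀ n, MeasurableSet (out n) := fun n => measurableSet_lt measurable_const hnorm
  have hG : Tendsto (fun n => G (out n)) atTop (𝓝 0) := by
    have hanti : Antitone out := fun n k hnk ξ hξ =>
      lt_of_le_of_lt (by exact_mod_cast hnk : (n : ℝ) ≤ k) hξ
    have hempty : ⋂ n, out n = ∅ := by
      refine Set.eq_empty_of_forall_notMem fun ξ hξ => ?_
      obtain ⟨n, hn⟩ := exists_nat_gt (max |ξ 0| |ξ 1|)
      exact lt_asymm hn (Set.mem_iInter.1 hξ n)
    have := tendsto_measure_iInter_atTop (μ := G) (fun n => (hout n).nullMeasurableSet) hanti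
      ⟨0, measure_ne_top _ _⟩
    rwa [hempty, measure_empty] at this
  rw [ENNReal.tendsto_nhds_zero]
  intro η hη
  have hη2 : 0 < η / 2 := ENNReal.half_pos hη.ne'
  obtain ⟨n, hn⟩ := ((ENNReal.tendsto_nhds_zero.1 hG) (η / 2) hη2).exists
  obtain ⟨β, hβ, hle⟩ := h.dataLaw_not_typical_le n
  filter_upwards [h.eventually_postProb_close n hB hε, eventually_gt_atTop 0,
    (ENNReal.tendsto_nhds_zero.1 hβ) (η / 2) hη2] with J hJ hJ0 hβJ
  set bad : Set (Trait × Data) := {p | ¬ m.Typical J p.1 p.2} ∩ Prod.fst ⁻¹' (out n)ᶜ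
  have hbad : MeasurableSet bad :=
    (measurableSet_not_typical m J).inter (measurable_fst (hout n).compl)
  have h1 : (G.compProd m.dataKernel) bad ≤ η / 2 := by
    rw [Measure.compProd_apply hbad]
    refine (lintegral_mono (g := fun _ => η / 2) fun ξ => ?_).trans (by simp)
    by_cases hξ : ξ ∈ out n
    · have : Prod.mk ξ ⁻¹' bad = ∅ := by
        ext x; simp [bad, hξ]
      rw [this, measure_empty]
      exact zero_le
    · have h0 : |ξ 0| ≤ n := (le_max_left _ _).trans (not_lt.1 hξ)
      refine (measure_mono fun x hx => ?_).trans ((hle J hJ0 ξ h0).trans hβJ)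
      exact hx.1
  have h2 : (G.compProd m.dataKernel) (Prod.fst ⁻¹' out n) ≤ η / 2 := by
    rw [← Measure.fst_apply (hout n), Measure.fst_compProd]
    exact hn
  have hsub : {p : Trait × Data | ε ≤ edist (m.postProb B J p.2) (stdNormal₂.real B)}
      ⊆ bad ∪ Prod.fst ⁻¹' out n := fun p hp => by
    by_cases hξ : p.1 ∈ out n
    · exact Or.inr hξ
    · refine Or.inl ⟨fun ht => ?_, hξ⟩
      have hle : max |p.1 0| |p.1 1| ≤ n := not_lt.1 hξ
      exact absurd (hJ p.1 p.2 ((le_max_left _ _).trans hle) ((le_max_right _ _).trans hle) ht)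
        (not_lt.2 hp)
  calc _ ≤ (G.compProd m.dataKernel) (bad ∪ Prod.fst ⁻¹' out n) := measure_mono hsub
    _ ≤ η / 2 + η / 2 := (measure_union_le _ _).trans (add_le_add h1 h2)
    _ = η := ENNReal.add_halves η

end Params
end LaRT

end

theorem mainTheorem3 (m : LaRT.Params) :
    -- the posterior mode is well defined, and the precision formula for the ability holds
    (|m.rho| < 1 →
      (∀ (J : ℕ) (x : LaRT.Data), (∀ j < J, 0 < (x j).2) →
        ∃! ξ : LaRT.Trait, ∀ η, m.logPost J x η ≤ m.logPost J x ξ) ∧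
      (∀ (J : ℕ) (ξ : LaRT.Trait),
        m.postInfo J ξ 0 0 =
          1 / (1 - m.rho ^ 2) + ∑ j ∈ Finset.range J, m.accInfo j (ξ 0))) ∧
    (m.BoundedItems →
      -- data generated from a fixed trait
      (∀ ξ₀ : LaRT.Trait, m.Identifiable ξ₀ → m.NonDegenerate ξ₀ →
        ∀ B : Set LaRT.Trait, MeasurableSet B →
          TendstoInMeasure (m.dataLaw ξ₀) (fun J x => m.postProb B J x) atTop
            (fun _ => LaRT.stdNormal₂.real B)) ∧
      -- data generated from a trait drawn from an absolutely continuous law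
      (∀ G : Measure LaRT.Trait, IsProbabilityMeasure G → G ≪ volume →
        (∀ᵐ ξ₀ ∂G, m.Identifiable ξ₀ ∧ m.NonDegenerate ξ₀) →
        ∀ B : Set LaRT.Trait, MeasurableSet B →
          TendstoInMeasure (G.compProd m.dataKernel)
            (fun J (p : LaRT.Trait × LaRT.Data) => m.postProb B J p.2) atTop
            (fun _ => LaRT.stdNormal₂.real B))) := by
  refine ⟨fun hρ => ⟨fun J x hx => m.existsUnique_mode hρ hx, fun J ξ => ?_⟩, fun hb => ⟨?_, ?_⟩⟩
  · rw [m.postInfo_eq hρ]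
    rfl
  · intro ξ₀ hi hn B hB
    obtain ⟨A, κ, J₁, h⟩ := LaRT.Params.exists_regular hb hi hn
    exact h.tendstoInMeasure_dataLaw ξ₀ hB
  · intro G hG _ hae B hB
    obtain ⟨ξ₀, hi, hn⟩ := hae.exists
    obtain ⟨A, κ, J₁, h⟩ := LaRT.Params.exists_regular hb hi hn
    exact h.tendstoInMeasure_compProd G hB
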